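/- **Boundary $C^{1,\alpha}$ estimate for pseudo-holomorphic half disks.** Write $\mathbb D\subset\mathbb C$ for the open unit disk, $\mathbb D_+=\{z\in\mathbb D:\operatorname{Im}z\ge 0\}$ for the half disk (with its flat boundary part) and $\partial_0\mathbb D_+=\mathbb D\cap\mathbb R$. Let $\mathbb D'$ be a closed disk contained in $\mathbb D$ and $\mathbb D'_+=\{z\in\mathbb D':\operatorname{Im}z\ge0\}$. Let $n\ge 0$, $0<\alpha<1$, $\rho>0$ and $\Lambda\in\mathbb R$. Then there is a constant $C_\alpha$, depending only on $n,\alpha,\mathbb D',\rho,\Lambda$, such that the following holds. Let $J$ be a smooth almost complex structure on $\mathbb R^{2n}$, let $L\subset\mathbb R^{2n}$ be a smooth embedded $n$-dimensional submanifold that is totally real ($T_pL\cap J_pT_pL=0$ for all $p\in L$), and let $K\subset\mathbb R^{2n}$ be a set over which $(J,L)$ has bounded local geometry with constants $\rho,\Lambda$, that is: 1. $|J_wv|\le\Lambda|v|$ and $|(D_uJ)_w v|\le\Lambda|u||v|$ for all $w\in K$ and $u,v\in\mathbb R^{2n}$; 2. for every $p\in L\cap K$ there is a smooth chart $\varphi$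 of $\mathbb R^{2n}$, defined on an open set $U$ containing the ball $B(p,\rho)$, such that for $w\in U$ one has $w\in L$ if and only if $\varphi(w)\in\mathbb R^n\times\{0\}$, and such that $|D\varphi_w v|\le\Lambda|v|$, $|v|\le\Lambda|D\varphi_w v|$, $|D^2\varphi_w(u,v)|\le\Lambda|u||v|$ for all $w\in B(p,\rho)$ and $u,v\in\mathbb R^{2n}$; 3. $|v|\le\Lambda|u+J_pv|$ for all $p\in L\cap K$ and $u,v\in T_pL$. (For fixed $J$ and fixed closed $L$ such constants exist for every compact set $K$; also $K=\mathbb R^{2n}$ is allowed.) Let $f:(\mathbb D_+,\partial_0\mathbb D_+)\to(\mathbb R^{2n},L,J)$ be a pseudo-holomorphic map with $f(\mathbb D_+)\subset K$, i.e. $f$ is $C^1$ on $\mathbb D_+$ (up to $\partial_0\mathbb D_+$), $Df_z(iv)=J_{f(z)}Df_z(v)$ for all $z\in\mathbb D_+$ and $v\in\mathbb C$, and $f(\partial_0\mathbb D_+)\subset L$. Then $$|Df|_{C^\alpha(\mathbb D'_+)}\le C_\alpha\sup_{z\in\mathbb D_+}\bigl(|Df(z)|+|Df(z)|^2\bigr),$$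 where $|g|_{C^\alpha(S)}=\sup_S|g|+\sup_{z_1\ne z_2\in S}|g(z_1)-g(z_2)|/|z_1-z_2|^\alpha$. (If the right-hand side is infinite there is nothing to prove.) -/

import Mathlib

open Set Filter Topology
open scoped NNReal ENNReal ContDiff

/-- The space `ℝ²ⁿ` with its Euclidean norm. -/
abbrev RSpace (n : ℕ) : Type := EuclideanSpace ℝ (Fin (2 * n))

/-- The linear subspace `ℝⁿ × {0}` of `ℝ²ⁿ = ℝⁿ × ℝⁿ`. -/
def flatSubspace (n : ℕ) : Submodule ℝ (RSpace n) where
  carrier := {x | ∀ i : Fin (2 * n), n ≤ i.val → x i = 0}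
  add_mem' := by
    intro a b ha hb i hi
    simp [ha i hi, hb i hi]
  zero_mem' := by
    intro i _
    simp
  smul_mem' := by
    intro c a ha i hi
    simp [ha i hi]

/-- A smooth almost complex structure on `ℝ²ⁿ`: a smooth field of endomorphisms with `J² = -1`. -/
structure IsAlmostComplexStructure {n : ℕ} (J : RSpace n → RSpace n →L[ℝ] RSpace n) : Prop where
  smooth : ContDiff ℝ ∞ J
  sq_eq_neg : ∀ w v, J w (J w v) = -v

/-- A smooth chart of `ℝ²ⁿ` which carries the part of `L` in its source to `ℝⁿ × {0}`. -/
structure IsSliceChart {n : ℕ} (L : Set (RSpace n))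
    (φ : OpenPartialHomeomorph (RSpace n) (RSpace n)) : Prop where
  smooth : ContDiffOn ℝ ∞ φ φ.source
  smooth_symm : ContDiffOn ℝ ∞ φ.symm φ.target
  mem_iff : ∀ w ∈ φ.source, w ∈ L ↔ φ w ∈ flatSubspace n

/-- `L` is an (embedded) smooth submanifold of `ℝ²ⁿ` of the middle dimension `n`. -/
def IsMiddleSubmanifold {n : ℕ} (L : Set (RSpace n)) : Prop :=
  ∀ p ∈ L, ∃ φ : OpenPartialHomeomorph (RSpace n) (RSpace n), p ∈ φ.source ∧ IsSliceChart L φ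

/-- The tangent space `T_p L`: the velocities at `p` of the curves in `L` through `p`. -/
def tangentVectors {n : ℕ} (L : Set (RSpace n)) (p : RSpace n) : Set (RSpace n) :=
  {v | ∃ γ : ℝ → RSpace n, γ 0 = p ∧ (∀ᶠ t in 𝓝 (0 : ℝ), γ t ∈ L) ∧ HasDerivAt γ v 0}

/-- `L` is totally real: `T_p L ∩ J_p (T_p L) = 0` at every point `p` of `L`. -/
def IsTotallyReal {n : ℕ} (J : RSpace n → RSpace n →L[ℝ] RSpace n) (L : Set (RSpace n)) : Prop :=
  ∀ p ∈ L, ∀ v ∈ tangentVectors L p, J p v ∈ tangentVectors L p → v = 0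

/-- The pair `(J, L)` has bounded local geometry over the set `K`, with constants `ρ` and `Λ`:
`J` and its first derivative are bounded by `Λ` on `K`, the submanifold `L` is straightened on the
`ρ`-ball about each of its points in `K` by a slice chart with first and second derivatives and
inverse of the first derivative bounded by `Λ`, and `L` is uniformly totally real over `K`. -/
structure HasBoundedGeometryOn {n : ℕ} (J : RSpace n → RSpace n →L[ℝ] RSpace n)
    (L K : Set (RSpace n)) (ρ Λ : ℝ) : Prop where
  norm_le : ∀ w ∈ K, ∀ v, ‖J w v‖ ≤ Λ * ‖v‖
  norm_fderiv_le : ∀ w ∈ K, ∀ u v, ‖fderiv ℝ J w u v‖ ≤ Λ * ‖u‖ * ‖v‖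
  exists_chart : ∀ p ∈ L ∩ K, ∃ φ : OpenPartialHomeomorph (RSpace n) (RSpace n),
    IsSliceChart L φ ∧ Metric.ball p ρ ⊆ φ.source ∧
      ∀ w ∈ Metric.ball p ρ,
        (∀ v, ‖fderiv ℝ φ w v‖ ≤ Λ * ‖v‖ ∧ ‖v‖ ≤ Λ * ‖fderiv ℝ φ w v‖) ∧
        (∀ u v, ‖fderiv ℝ (fderiv ℝ φ) w u v‖ ≤ Λ * ‖u‖ * ‖v‖)
  uniformly_totallyReal : ∀ p ∈ L ∩ K, ∀ u ∈ tangentVectors L p, ∀ v ∈ tangentVectors L p,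
    ‖v‖ ≤ Λ * ‖u + J p v‖

/-- The half disk `𝔻₊`, together with its flat boundary part `∂₀𝔻₊ = 𝔻 ∩ ℝ`. -/
def halfDisk : Set ℂ := {z | ‖z‖ < 1 ∧ 0 ≤ z.im}

/-- The part `𝔻'₊` in the closed upper half plane of the closed disk `𝔻'` with centre `c` and
radius `r`. -/
def smallHalfDisk (c : ℂ) (r : ℝ) : Set ℂ := {z | z ∈ Metric.closedBall c r ∧ 0 ≤ z.im}

/-- The differential `Df`, one-sided at the points of `∂₀𝔻₊`. -/
noncomputable def halfDiskDeriv {n : ℕ} (f : ℂ → RSpace n) (z : ℂ) : ℂ →L[ℝ] RSpace n :=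
  fderivWithin ℝ f halfDisk z

/-- `f : (𝔻₊, ∂₀𝔻₊) → (ℝ²ⁿ, L, J)` is a pseudo-holomorphic map: it is `C¹` up to `∂₀𝔻₊`,
satisfies `Df ∘ i = J_f ∘ Df`, and maps `∂₀𝔻₊` to `L`. -/
structure IsPseudoHolomorphic {n : ℕ} (J : RSpace n → RSpace n →L[ℝ] RSpace n)
    (L : Set (RSpace n)) (f : ℂ → RSpace n) : Prop where
  contDiffOn : ContDiffOn ℝ 1 f halfDisk
  map_I_mul : ∀ z ∈ halfDisk, ∀ v : ℂ,
    halfDiskDeriv f z (Complex.I * v) = J (f z) (halfDiskDeriv f z v)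
  map_boundary : ∀ z ∈ halfDisk, z.im = 0 → f z ∈ L

/-- The Hölder norm `|g|_{C^α(S)} = sup_S |g| + [g]_{C^α(S)}`, with values in `[0, ∞]`. -/
noncomputable def eHolderFullNorm {F : Type*} [NormedAddCommGroup F] (α : ℝ≥0) (S : Set ℂ)
    (g : ℂ → F) : ℝ≥0∞ :=
  (⨆ z ∈ S, ‖g z‖ₑ) + eHolderNorm α (S.domRestrict g)

/-! The estimate is a pointwise (Campanato-type) Schauder argument. It suffices that at every point
`z₀` the map has a first order expansion `f z = f z₀ + Df(z₀)(z - z₀) + O(|z - z₀|^(1+α))` with a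
uniform constant: two expansions of the same map, compared on a disk of radius comparable to `|z₁ -
z₂|`, force `Df(z₁) - Df(z₂) = O(|z₁ - z₂|^α)` (`norm_sub_le_of_affine_approx`,
`exists_holder_bound`).

The expansions come from freezing the complex structure at `f z₀`. If `|Df| ≤ M`, then `J(f z) - J(f
z₀) = O(M|z - z₀|)`, so `f` solves the Cauchy–Riemann equation for the constant structure `J(f z₀)`
up to `O(M²|z - z₀|)`. For scalar functions the Cauchy–Pompeiu formula (`integral_inv_sub_mul_dbar`)
turns such a bound on `∂̄` into the expansion (`exists_norm_sub_affine_le`): the Cauchy kernel minus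
its first order Taylor polynomial at `0` is `z²/(ζ²(ζ - z))`, and `|∂̄u| ≤ B|ζ|` removes one power
of `ζ`. Complex linear functionals reduce vector-valued maps to scalar ones.

At a boundary point, a chart tangent to the identity makes `L` a linear totally real subspace `W`
and adds only a defect of the same order (`exists_boundary_expansion`). The functionals are built
from the projection to `W` along `JW`, hence are real on `W`, and Schwarz reflection reduces to a
full disk. The reflected function may fail to be differentiable on the real line, so the
Cauchy–Pompeiu formula is proved for functions that are merely continuous there.

At a point at distance `d` from the boundary, the interior expansion on the disk of radius `d` is
applied to `f` minus its affine approximation at the nearest boundary point (`exists_expansion`).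
This keeps the constant independent of `d`.

All of this holds at a scale `s` with `Ms < ρ` and `Ms ≤ 1`, and gives a Hölder constant `C M /
s^α`. Choosing `s` comparable to `1/(1 + M)` yields the right-hand side `M + M²`. -/

open MeasureTheory

/-! ### The operator `∂̄` and Stokes' theorem across the real line -/

/-- Twice the Cauchy–Riemann operator, `∂ₓ + i ∂ᵧ`, on complex-valued functions of one complex
variable. -/
noncomputable def dbar (g : ℂ → ℂ) (z : ℂ) : ℂ :=
  fderiv ℝ g z 1 + Complex.I * fderiv ℝ g z Complex.I

lemma measurable_dbar (g : ℂ → ℂ) : Measurable (dbar g) :=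
  (measurable_fderiv_apply_const ℝ g 1).add
    ((measurable_fderiv_apply_const ℝ g Complex.I).const_mul _)

lemma HasFDerivAt.dbar_eq {g : ℂ → ℂ} {g' : ℂ →L[ℝ] ℂ} {z : ℂ} (h : HasFDerivAt g g' z) :
    dbar g z = g' 1 + Complex.I * g' Complex.I := by
  rw [dbar, h.fderiv]

lemma dbar_mul {g h : ℂ → ℂ} {z : ℂ} (hg : DifferentiableAt ℝ g z)
    (hh : DifferentiableAt ℝ h z) :
    dbar (fun w => g w * h w) z = g z * dbar h z + h z * dbar g z := by
  have h := (hg.hasFDerivAt.mul hh.hasFDerivAt).dbar_eq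
  refine h.trans ?_
  simp only [dbar, add_apply, smul_apply, smul_eq_mul]
  ring

lemma Filter.EventuallyEq.dbar_eq {g h : ℂ → ℂ} {z : ℂ} (hgh : g =ᶠ[𝓝 z] h) :
    dbar g z = dbar h z := by
  rw [dbar, dbar, hgh.fderiv_eq]

lemma volume_setOf_im_eq_zero : volume {z : ℂ | z.im = 0} = 0 := by
  have h : (LinearMap.ker Complex.imLm : Submodule ℝ ℂ) ≠ ⊤ := by
    intro h
    have : Complex.I ∈ LinearMap.ker Complex.imLm := by rw [h]; trivial
    simp at this
  exact Measure.addHaar_submodule volume _ h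

lemma ae_im_ne_zero : ∀ᵐ z : ℂ, z.im ≠ 0 := by
  rw [ae_iff]
  simpa using volume_setOf_im_eq_zero

lemma intervalIntegral_intervalIntegral_eq_setIntegral {F : ℂ → ℂ} {a b c d : ℝ} (hab : a ≤ b)
    (hcd : c ≤ d) (hF : Integrable F) :
    ∫ x in a..b, ∫ y in c..d, F (x + y * Complex.I) = ∫ z in Ioc a b ×ℂ Ioc c d, F z := by
  have h1 := (Complex.volume_preserving_equiv_real_prod.symm).setIntegral_preimage_emb
    (Complex.measurableEquivRealProd.symm.measurableEmbedding) F (Ioc a b ×ℂ Ioc c d)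
  have h2 : (Complex.measurableEquivRealProd.symm ⁻¹' (Ioc a b ×ℂ Ioc c d)) =
      Ioc a b ×ˢ Ioc c d := by
    ext p
    simp [Complex.mem_reProdIm]
  have h3 : Integrable (fun p : ℝ × ℝ => F (Complex.measurableEquivRealProd.symm p)) :=
    (Complex.volume_preserving_equiv_real_prod.symm).integrable_comp_of_integrable hF
  rw [← h1, h2, Measure.volume_eq_prod, setIntegral_prod _ h3.integrableOn,
    intervalIntegral.integral_of_le hab]
  refine integral_congr_ae (Eventually.of_forall fun x => ?_)
  simp only
  rw [intervalIntegral.integral_of_le hcd]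
  refine integral_congr_ae (Eventually.of_forall fun y => ?_)
  simp only [Complex.measurableEquivRealProd_symm_apply]
  rw [Complex.mk_eq_add_mul_I]

/-- Stokes' theorem. The exceptional set allowed in the rectangle formula is countable, which
excludes a line, so the formula is applied separately above and below the real axis. The two
integrals along the common edge cancel by continuity of `v`; the other edges lie outside the
support. -/
lemma integral_dbar_eq_zero {v : ℂ → ℂ} (hv : Continuous v) (hsupp : ∀ z, 1 ≤ ‖z‖ → v z = 0)
    (hd : ∀ z : ℂ, z.im ≠ 0 → DifferentiableAt ℝ v z) (hi : Integrable (dbar v)) :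
    ∫ z, dbar v z = 0 := by
  have hIF : (fun z => Complex.I • fderiv ℝ v z 1 - fderiv ℝ v z Complex.I) =
      fun z => Complex.I * dbar v z := by
    funext z
    simp only [dbar, smul_eq_mul]
    linear_combination (-(fderiv ℝ v z Complex.I)) * Complex.I_mul_I
  have hFi : Integrable (fun z => Complex.I * dbar v z) := hi.const_mul _
  -- Only the horizontal edges survive, since `v` vanishes on `Re z = ±2`.
  have key : ∀ c d : ℝ, c ≤ d → (∀ y ∈ Ioo c d, y ≠ 0) →
      (∫ x : ℝ in (-2)..2, v (x + c * Complex.I)) - (∫ x : ℝ in (-2)..2, v (x + d * Complex.I)) =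
        ∫ z in Ioc (-2) 2 ×ℂ Ioc c d, Complex.I * dbar v z := by
    intro c d hcd h0
    have := Complex.integral_boundary_rect_of_hasFDerivAt_real_off_countable v (fderiv ℝ v)
      ⟨-2, c⟩ ⟨2, d⟩ ∅ countable_empty hv.continuousOn ?_ ?_
    · rw [← intervalIntegral_intervalIntegral_eq_setIntegral (by norm_num) hcd hFi]
      have hz : ∀ x : ℝ, 1 ≤ |x| → ∀ y : ℝ, v (x + y * Complex.I) = 0 := fun x hx y =>
        hsupp _ (hx.trans (by simpa using Complex.abs_re_le_norm (x + y * Complex.I)))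
      have hr : ∀ y : ℝ, v (((2 : ℝ) : ℂ) + y * Complex.I) = 0 := hz 2 (by norm_num)
      have hl : ∀ y : ℝ, v (((-2 : ℝ) : ℂ) + y * Complex.I) = 0 := hz (-2) (by norm_num)
      simp only [hr, hl, intervalIntegral.integral_zero, smul_zero, sub_zero, add_zero] at this
      rw [this]
      refine intervalIntegral.integral_congr fun x _ => intervalIntegral.integral_congr fun y _ => ?_
      exact congrFun hIF _
    · rintro x ⟨hx, -⟩
      simp only [Complex.mem_reProdIm, min_eq_left hcd, max_eq_right hcd] at hx
      exact (hd x (h0 _ hx.2)).hasFDerivAt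
    · rw [hIF]
      exact hFi.integrableOn
  have hup := key 0 2 (by norm_num) fun y hy => hy.1.ne'
  have hlo := key (-2) 0 (by norm_num) fun y hy => hy.2.ne
  have hz : ∀ y : ℝ, 1 ≤ |y| → ∀ x : ℝ, v (x + y * Complex.I) = 0 := fun y hy x =>
    hsupp _ (hy.trans (by simpa using Complex.abs_im_le_norm (x + y * Complex.I)))
  have ht := hz 2 (by norm_num)
  have hb := hz (-2) (by norm_num)
  simp only [ht, hb, intervalIntegral.integral_zero] at hup hlo
  have hm : ∀ a b c d : ℝ, MeasurableSet (Ioc a b ×ℂ Ioc c d) := fun a b c d =>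
    (measurableSet_Ioc.preimage Complex.measurable_re).inter
      (measurableSet_Ioc.preimage Complex.measurable_im)
  have hdisj : Disjoint (Ioc (-2 : ℝ) 2 ×ℂ Ioc (0 : ℝ) 2) (Ioc (-2 : ℝ) 2 ×ℂ Ioc (-2 : ℝ) 0) := by
    rw [Set.disjoint_left]
    intro z h1 h2
    exact absurd h1.2.1 (not_lt.2 h2.2.2)
  have hsum : ∫ z in (Ioc (-2 : ℝ) 2 ×ℂ Ioc (0 : ℝ) 2) ∪ (Ioc (-2 : ℝ) 2 ×ℂ Ioc (-2 : ℝ) 0),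
      Complex.I * dbar v z = 0 := by
    rw [setIntegral_union hdisj (hm _ _ _ _) hFi.integrableOn hFi.integrableOn, ← hup, ← hlo]
    simp
  rw [setIntegral_eq_integral_of_forall_compl_eq_zero, integral_const_mul] at hsum
  · simpa using hsum
  · intro z hz
    have h1 : 1 < ‖z‖ := by
      by_contra hle
      push Not at hle
      have hre := abs_le.1 ((Complex.abs_re_le_norm z).trans hle)
      have him := abs_le.1 ((Complex.abs_im_le_norm z).trans hle)
      apply hz
      rcases le_or_gt z.im 0 with h | h
      · exact Or.inr ⟨⟨by linarith, by linarith⟩, ⟨by linarith, h⟩⟩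
      · exact Or.inl ⟨⟨by linarith, by linarith⟩, ⟨h, by linarith⟩⟩
    have h2 : v =ᶠ[𝓝 z] fun _ => 0 := by
      filter_upwards [(isOpen_lt continuous_const continuous_norm).mem_nhds h1] with w hw
      exact hsupp w (le_of_lt hw)
    rw [h2.dbar_eq]
    simp [dbar]

lemma dbar_id (z : ℂ) : dbar (fun w => w) z = 0 := by
  have h : HasFDerivAt (fun w : ℂ => w) (ContinuousLinearMap.id ℝ ℂ) z := hasFDerivAt_id z
  rw [h.dbar_eq]
  simp

lemma dbar_const (a z : ℂ) : dbar (fun _ => a) z = 0 := by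
  simp [dbar]

lemma dbar_conj (z : ℂ) : dbar (fun w => (starRingEnd ℂ) w) z = 2 := by
  have h : HasFDerivAt (fun w => (starRingEnd ℂ) w) (Complex.conjCLE : ℂ →L[ℝ] ℂ) z :=
    Complex.conjCLE.hasFDerivAt
  rw [h.dbar_eq]
  norm_num

lemma dbar_add {g h : ℂ → ℂ} {z : ℂ} (hg : DifferentiableAt ℝ g z)
    (hh : DifferentiableAt ℝ h z) :
    dbar (fun w => g w + h w) z = dbar g z + dbar h z := by
  have h := (hg.hasFDerivAt.add hh.hasFDerivAt).dbar_eq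
  refine h.trans ?_
  simp only [dbar, add_apply]
  ring

lemma dbar_comp_sub (g : ℂ → ℂ) (z w : ℂ) : dbar (fun ζ => g (ζ - z)) w = dbar g (w - z) := by
  simp only [dbar]
  rw [fderiv_comp_sub]

/-! ### The smoothed Cauchy kernel -/

/-- A smooth approximation of the Cauchy kernel `1 / w`, to which it converges as `c → ∞`. -/
noncomputable def smoothCauchyKernel (c : ℝ) (w : ℂ) : ℂ :=
  (c : ℂ) ^ 2 * (starRingEnd ℂ) w / (1 + (c : ℂ) ^ 2 * (w * (starRingEnd ℂ) w))

lemma smoothCauchyKernel_denom (c : ℝ) (w : ℂ) :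
    1 + (c : ℂ) ^ 2 * (w * (starRingEnd ℂ) w) = ((1 + c ^ 2 * ‖w‖ ^ 2 : ℝ) : ℂ) := by
  rw [Complex.mul_conj']
  push_cast
  ring

lemma smoothCauchyKernel_denom_ne (c : ℝ) (w : ℂ) :
    1 + (c : ℂ) ^ 2 * (w * (starRingEnd ℂ) w) ≠ 0 := by
  rw [smoothCauchyKernel_denom]
  exact Complex.ofReal_ne_zero.2 (by positivity)

lemma differentiable_conj : Differentiable ℝ fun w : ℂ => (starRingEnd ℂ) w :=
  Complex.conjCLE.differentiable

lemma differentiable_smoothCauchyKernel (c : ℝ) : Differentiable ℝ (smoothCauchyKernel c) := by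
  intro w
  have := differentiable_conj
  unfold smoothCauchyKernel
  simp only [div_eq_mul_inv]
  exact DifferentiableAt.fun_mul (by fun_prop)
    (DifferentiableAt.fun_inv (by fun_prop) (smoothCauchyKernel_denom_ne c w))

/-- The kernel times its denominator is `c² w̄`, and the product rule gives the quotient. The result
is the dilation by `c` of a fixed positive integrable profile, so it acts as an approximate
identity. -/
lemma dbar_smoothCauchyKernel (c : ℝ) (w : ℂ) :
    dbar (smoothCauchyKernel c) w = ((2 * c ^ 2 / (1 + c ^ 2 * ‖w‖ ^ 2) ^ 2 : ℝ) : ℂ) := by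
  have hne := smoothCauchyKernel_denom_ne c w
  have hd := differentiable_conj
  have hN : dbar (fun w => 1 + (c : ℂ) ^ 2 * (w * (starRingEnd ℂ) w)) w = (c : ℂ) ^ 2 * (2 * w) := by
    rw [dbar_add (by fun_prop) (by fun_prop), dbar_mul (by fun_prop) (by fun_prop),
      dbar_mul (by fun_prop) (by fun_prop), dbar_const, dbar_const, dbar_id, dbar_conj]
    ring
  have h1 : dbar (fun w => smoothCauchyKernel c w *
      (1 + (c : ℂ) ^ 2 * (w * (starRingEnd ℂ) w))) w = (c : ℂ) ^ 2 * 2 := by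
    have : (fun w => smoothCauchyKernel c w * (1 + (c : ℂ) ^ 2 * (w * (starRingEnd ℂ) w))) =
        fun w => (c : ℂ) ^ 2 * (starRingEnd ℂ) w := by
      funext w
      exact div_mul_cancel₀ _ (smoothCauchyKernel_denom_ne c w)
    rw [this, dbar_mul (by fun_prop) (by fun_prop), dbar_const, dbar_conj]
    ring
  rw [dbar_mul (differentiable_smoothCauchyKernel c w) (by fun_prop), hN] at h1
  have h2 : dbar (smoothCauchyKernel c) w = 2 * (c : ℂ) ^ 2 /
      (1 + (c : ℂ) ^ 2 * (w * (starRingEnd ℂ) w)) ^ 2 := by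
    rw [eq_div_iff (pow_ne_zero 2 hne)]
    have h3 : smoothCauchyKernel c w * (1 + (c : ℂ) ^ 2 * (w * (starRingEnd ℂ) w)) =
        (c : ℂ) ^ 2 * (starRingEnd ℂ) w := div_mul_cancel₀ _ hne
    linear_combination (1 + (c : ℂ) ^ 2 * (w * (starRingEnd ℂ) w)) * h1
      - (c : ℂ) ^ 2 * (2 * w) * h3
  rw [h2, smoothCauchyKernel_denom]
  push_cast
  ring

lemma norm_smoothCauchyKernel_le (c : ℝ) (w : ℂ) : ‖smoothCauchyKernel c w‖ ≤ ‖w‖⁻¹ := by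
  rw [smoothCauchyKernel, smoothCauchyKernel_denom]
  rw [norm_div, norm_mul, norm_pow, Complex.norm_real, Complex.norm_real, RCLike.norm_conj,
    Real.norm_eq_abs, Real.norm_eq_abs, sq_abs, abs_of_pos (by positivity)]
  rcases eq_or_ne w 0 with rfl | hw
  · simp
  · have := norm_pos_iff.2 hw
    rw [div_le_iff₀ (by positivity), inv_mul_eq_div, le_div_iff₀ this]
    nlinarith

lemma tendsto_smoothCauchyKernel {w : ℂ} (hw : w ≠ 0) :
    Tendsto (fun c : ℝ => smoothCauchyKernel c w) atTop (𝓝 w⁻¹) := by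
  have hw' : (starRingEnd ℂ) w ≠ 0 := (map_ne_zero _).2 hw
  have h1 : Tendsto (fun c : ℝ => ((c ^ 2)⁻¹ : ℝ)) atTop (𝓝 0) :=
    (tendsto_pow_atTop two_ne_zero).inv_tendsto_atTop
  have h2 : Tendsto (fun c : ℝ => (starRingEnd ℂ) w / (((c ^ 2)⁻¹ : ℝ) + w * (starRingEnd ℂ) w))
      atTop (𝓝 ((starRingEnd ℂ) w / (((0 : ℝ) : ℂ) + w * (starRingEnd ℂ) w))) := by
    refine Tendsto.div tendsto_const_nhds ?_ (by simpa using hw)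
    exact ((Complex.continuous_ofReal.tendsto _).comp h1).add_const _
  have h3 : (starRingEnd ℂ) w / (((0 : ℝ) : ℂ) + w * (starRingEnd ℂ) w) = w⁻¹ := by
    simp only [Complex.ofReal_zero, zero_add]
    field_simp
  rw [h3] at h2
  refine h2.congr' ?_
  filter_upwards [eventually_gt_atTop (0 : ℝ)] with c hc
  have hc' : (c : ℂ) ≠ 0 := Complex.ofReal_ne_zero.2 hc.ne'
  rw [smoothCauchyKernel]
  have := smoothCauchyKernel_denom_ne c w
  push_cast
  rw [div_eq_div_iff _ this]
  · field_simp
  · intro h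
    apply this
    have := congrArg (fun t => (c : ℂ) ^ 2 * t) h
    simpa [mul_add, hc'] using this

/-! ### The Cauchy–Pompeiu formula -/

lemma integrable_one_add_norm_sq_inv_sq : Integrable fun w : ℂ => ((1 + ‖w‖ ^ 2) ^ 2)⁻¹ := by
  have h := integrable_rpow_neg_one_add_norm_sq (E := ℂ) (μ := volume) (r := 4) (by
    rw [Complex.finrank_real_complex]; norm_num)
  refine h.congr (Eventually.of_forall fun w => ?_)
  simp only
  rw [show (-(4 : ℝ) / 2) = -((2 : ℕ) : ℝ) by norm_num, Real.rpow_neg (by positivity),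
    Real.rpow_natCast]

lemma integral_one_add_norm_sq_inv_sq_pos : 0 < ∫ w : ℂ, ((1 + ‖w‖ ^ 2) ^ 2)⁻¹ := by
  rw [integral_pos_iff_support_of_nonneg (fun w => by positivity) integrable_one_add_norm_sq_inv_sq]
  have : Function.support (fun w : ℂ => ((1 + ‖w‖ ^ 2) ^ 2)⁻¹) = univ := by
    ext w
    simp only [Function.mem_support, mem_univ, iff_true]
    positivity
  rw [this]
  simp

lemma integrableOn_norm_sub_rpow {s : ℝ} (hs : s < 2) (z : ℂ) (R : ℝ) :
    IntegrableOn (fun ζ : ℂ => ‖ζ - z‖ ^ (-s)) (Metric.closedBall 0 R) := by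
  have h : LocallyIntegrable (fun ζ : ℂ => ‖ζ‖ ^ (-s)) := by
    refine locallyIntegrable_of_norm_le_rpow (C := 1) (α := s) ?_ ?_ ?_ ?_
    · rw [Complex.finrank_real_complex]; norm_num
    · rw [Complex.finrank_real_complex]; exact_mod_cast hs
    · refine Eventually.of_forall fun x => ?_
      rw [one_mul, Real.norm_of_nonneg (by positivity)]
    · exact (measurable_norm.pow_const _).aestronglyMeasurable
  have h2 := (h.integrableOn_isCompact (isCompact_closedBall (-z) R))
  have h3 := (measurePreserving_sub_right volume z).integrableOn_comp_preimage
    (Homeomorph.subRight z).measurableEmbedding (f := fun ζ : ℂ => ‖ζ‖ ^ (-s))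
    (s := Metric.closedBall (-z) R)
  refine (h3.2 h2).mono_set ?_
  intro x hx
  simpa [dist_eq_norm] using hx

lemma integrableOn_norm_sub_inv (z : ℂ) (R : ℝ) :
    IntegrableOn (fun ζ : ℂ => ‖ζ - z‖⁻¹) (Metric.closedBall 0 R) := by
  simpa [Real.rpow_neg_one] using integrableOn_norm_sub_rpow (s := 1) (by norm_num) z R

lemma dbar_eq_zero_of_one_lt_norm {u : ℂ → ℂ} (hsupp : ∀ z, 1 ≤ ‖z‖ → u z = 0) {z : ℂ}
    (hz : 1 < ‖z‖) : dbar u z = 0 := by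
  have h : u =ᶠ[𝓝 z] fun _ => 0 := by
    filter_upwards [(isOpen_lt continuous_const continuous_norm).mem_nhds hz] with w hw
    exact hsupp w (le_of_lt hw)
  rw [h.dbar_eq, dbar_const]

lemma ae_norm_dbar_le {u : ℂ → ℂ} (hsupp : ∀ z, 1 ≤ ‖z‖ → u z = 0) {B : ℝ}
    (hB : ∀ z : ℂ, z.im ≠ 0 → ‖dbar u z‖ ≤ B) :
    ∀ᵐ ζ : ℂ, ‖dbar u ζ‖ ≤ (Metric.closedBall (0 : ℂ) 1).indicator (fun _ => B) ζ := by
  filter_upwards [ae_im_ne_zero] with ζ hζ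
  by_cases h : ζ ∈ Metric.closedBall (0 : ℂ) 1
  · rw [indicator_of_mem h]
    exact hB ζ hζ
  · rw [indicator_of_notMem h, dbar_eq_zero_of_one_lt_norm hsupp (by simpa using h), norm_zero]

/-- A function which is bounded by `k` on the closed unit ball times `dbar u` is integrable. -/
lemma integrable_mul_dbar {u : ℂ → ℂ} (hsupp : ∀ z, 1 ≤ ‖z‖ → u z = 0) {B : ℝ}
    (hB : ∀ z : ℂ, z.im ≠ 0 → ‖dbar u z‖ ≤ B) {h : ℂ → ℂ} (hh : Measurable h)
    {k : ℂ → ℝ} (hk : IntegrableOn k (Metric.closedBall 0 1)) (hhk : ∀ ζ, ‖h ζ‖ ≤ k ζ) :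
    Integrable fun ζ => h ζ * dbar u ζ := by
  have hI : Integrable ((Metric.closedBall (0 : ℂ) 1).indicator fun ζ => k ζ * B) :=
    IntegrableOn.integrable_indicator (hk.mul_const B) Metric.isClosed_closedBall.measurableSet
  refine hI.mono' (hh.mul (measurable_dbar u)).aestronglyMeasurable ?_
  filter_upwards [ae_norm_dbar_le hsupp hB] with ζ hζ
  rw [norm_mul]
  by_cases h : ζ ∈ Metric.closedBall (0 : ℂ) 1
  · rw [indicator_of_mem h] at hζ ⊢
    exact mul_le_mul (hhk ζ) hζ (norm_nonneg _) ((norm_nonneg _).trans (hhk ζ))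
  · rw [indicator_of_notMem h] at hζ ⊢
    rw [le_antisymm hζ (norm_nonneg _), mul_zero]

/-- Dominated convergence: every smoothed kernel is bounded by the Cauchy kernel, which is
integrable on the unit disk. -/
lemma tendsto_integral_smoothCauchyKernel_mul_dbar {u : ℂ → ℂ} (hsupp : ∀ z, 1 ≤ ‖z‖ → u z = 0)
    {B : ℝ} (hB : ∀ z : ℂ, z.im ≠ 0 → ‖dbar u z‖ ≤ B) (z : ℂ) :
    Tendsto (fun c : ℝ => ∫ ζ, smoothCauchyKernel c (ζ - z) * dbar u ζ) atTop
      (𝓝 (∫ ζ, (ζ - z)⁻¹ * dbar u ζ)) := by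
  have hker := integrableOn_norm_sub_inv z 1
  refine tendsto_integral_filter_of_dominated_convergence
    ((Metric.closedBall (0 : ℂ) 1).indicator fun ζ => ‖ζ - z‖⁻¹ * B) ?_ ?_
    (IntegrableOn.integrable_indicator (hker.mul_const B)
      Metric.isClosed_closedBall.measurableSet) ?_
  · refine Eventually.of_forall fun c => AEMeasurable.aestronglyMeasurable ?_
    have := (differentiable_smoothCauchyKernel c).continuous.measurable
    exact ((this.comp (measurable_sub_const z)).mul (measurable_dbar u)).aemeasurable
  · refine Eventually.of_forall fun c => ?_
    filter_upwards [ae_norm_dbar_le hsupp hB] with ζ hζ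
    rw [norm_mul]
    by_cases h : ζ ∈ Metric.closedBall (0 : ℂ) 1
    · rw [indicator_of_mem h] at hζ ⊢
      exact mul_le_mul (norm_smoothCauchyKernel_le c _) hζ (norm_nonneg _) (by positivity)
    · rw [indicator_of_notMem h] at hζ ⊢
      rw [le_antisymm hζ (norm_nonneg _), mul_zero]
  · have : ∀ᵐ ζ : ℂ, ζ ≠ z := by simp [ae_iff, measure_singleton]
    filter_upwards [this] with ζ hζ
    exact (tendsto_smoothCauchyKernel (sub_ne_zero.2 hζ)).mul_const _

/-- After division by its total mass `κ`, the profile `(1 + ‖w‖²)⁻²` generates an approximate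
identity. The value of `κ` is never needed, only its positivity. -/
lemma tendsto_integral_dbar_smoothCauchyKernel_mul {u : ℂ → ℂ} (hu : Continuous u)
    (hui : Integrable u) (z : ℂ) :
    Tendsto (fun c : ℝ => ∫ ζ, u ζ * dbar (smoothCauchyKernel c) (ζ - z)) atTop
      (𝓝 (2 * (∫ w : ℂ, ((1 + ‖w‖ ^ 2) ^ 2)⁻¹ : ℝ) * u z)) := by
  set κ : ℝ := ∫ w : ℂ, ((1 + ‖w‖ ^ 2) ^ 2)⁻¹ with hκ
  have hκ0 : 0 < κ := integral_one_add_norm_sq_inv_sq_pos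
  have hφ := tendsto_integral_comp_smul_smul_of_integrable' (μ := volume)
    (φ := fun w : ℂ => κ⁻¹ * ((1 + ‖w‖ ^ 2) ^ 2)⁻¹) (g := u) (x₀ := z) (fun x => by positivity)
    (by rw [integral_const_mul, ← hκ, inv_mul_cancel₀ hκ0.ne']) ?_ hui hu.continuousAt
  swap
  · rw [Complex.finrank_real_complex]
    have h1 : Tendsto (fun x : ℂ => (1 + ‖x‖ ^ 2)⁻¹) (Bornology.cobounded ℂ) (𝓝 0) := by
      refine Tendsto.inv_tendsto_atTop (tendsto_atTop_add_const_left _ _ ?_)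
      exact (tendsto_pow_atTop two_ne_zero).comp tendsto_norm_cobounded_atTop
    have h2 := h1.const_mul κ⁻¹
    rw [mul_zero] at h2
    refine squeeze_zero (fun x => by positivity) (fun x => ?_) h2
    rw [mul_left_comm]
    refine mul_le_mul_of_nonneg_left ?_ (by positivity)
    rw [← div_eq_mul_inv, div_le_iff₀ (by positivity)]
    have : (1 + ‖x‖ ^ 2)⁻¹ * (1 + ‖x‖ ^ 2) ^ 2 = 1 + ‖x‖ ^ 2 := by
      field_simp
    rw [this]
    linarith
  refine (hφ.const_mul (2 * (κ : ℂ))).congr fun c => ?_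
  rw [Complex.finrank_real_complex, ← integral_const_mul]
  refine integral_congr_ae (Eventually.of_forall fun ζ => ?_)
  simp only
  rw [dbar_smoothCauchyKernel, norm_smul, mul_pow, Real.norm_eq_abs, sq_abs, norm_sub_rev z ζ,
    Complex.real_smul]
  have hκ' : (κ : ℂ) ≠ 0 := Complex.ofReal_ne_zero.2 hκ0.ne'
  push_cast
  field_simp

/-- The Cauchy–Pompeiu formula for a function with compact support, up to the value of the
constant. -/
theorem integral_inv_sub_mul_dbar {u : ℂ → ℂ} (hu : Continuous u)
    (hsupp : ∀ z, 1 ≤ ‖z‖ → u z = 0) (hd : ∀ z : ℂ, z.im ≠ 0 → DifferentiableAt ℝ u z) {B : ℝ}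
    (hB : ∀ z : ℂ, z.im ≠ 0 → ‖dbar u z‖ ≤ B) (z : ℂ) :
    ∫ ζ, (ζ - z)⁻¹ * dbar u ζ = -(2 * (∫ w : ℂ, ((1 + ‖w‖ ^ 2) ^ 2)⁻¹ : ℝ) * u z) := by
  have hcs : HasCompactSupport u := by
    refine HasCompactSupport.intro (isCompact_closedBall (0 : ℂ) 1) fun x hx => hsupp x ?_
    exact le_of_lt (by simpa using hx)
  have hui : Integrable u := hu.integrable_of_hasCompactSupport hcs
  refine tendsto_nhds_unique (tendsto_integral_smoothCauchyKernel_mul_dbar hsupp hB z)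
    ((tendsto_integral_dbar_smoothCauchyKernel_mul hu hui z).neg.congr fun c => ?_)
  have hKd := differentiable_smoothCauchyKernel c
  have hKc := hKd.continuous
  have hint : Integrable fun ζ => smoothCauchyKernel c (ζ - z) * dbar u ζ :=
    integrable_mul_dbar hsupp hB (hKc.measurable.comp (measurable_sub_const z))
      (integrableOn_norm_sub_inv z 1) fun ζ => norm_smoothCauchyKernel_le c (ζ - z)
  have hmol : Integrable fun ζ => u ζ * dbar (smoothCauchyKernel c) (ζ - z) := by
    refine Continuous.integrable_of_hasCompactSupport (hu.mul ?_) hcs.mul_right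
    simp only [dbar_smoothCauchyKernel]
    refine Complex.continuous_ofReal.comp (continuous_const.div (by fun_prop) fun ζ => ?_)
    positivity
  have hprod : ∀ᵐ ζ, dbar (fun ζ => u ζ * smoothCauchyKernel c (ζ - z)) ζ =
      u ζ * dbar (smoothCauchyKernel c) (ζ - z) + smoothCauchyKernel c (ζ - z) * dbar u ζ := by
    filter_upwards [ae_im_ne_zero] with ζ hζ
    rw [dbar_mul (hd ζ hζ) (by fun_prop), dbar_comp_sub]
  -- Integration by parts: the integral of `∂̄` of the product `u(ζ) K_c(ζ - z)` vanishes, where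
  -- `K_c` is the smoothed kernel.
  have hv := integral_dbar_eq_zero (v := fun ζ => u ζ * smoothCauchyKernel c (ζ - z))
    (hu.mul (by fun_prop)) (fun ζ hζ => by simp [hsupp ζ hζ])
    (fun ζ hζ => (hd ζ hζ).mul (by fun_prop))
    ((hmol.add hint).congr (hprod.mono fun ζ hζ => hζ.symm))
  rw [integral_congr_ae hprod, integral_add hmol hint] at hv
  linear_combination (-1 : ℂ) * hv

/-! ### Expansions of scalar functions with small `∂̄` -/

/-- As `t ≤ 2q`, the surplus factor `t^(1-α)` is absorbed by the larger distance `q`; the remaining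
`q^(-α)` is at most `p^(-α)`. The resulting singularity of order `1 + α < 2` is integrable in the
plane. -/
lemma sq_div_mul_le_aux {α : ℝ} (hα0 : 0 < α) (hα1 : α < 1) {t p q : ℝ} (ht : 0 < t) (hp : 0 < p)
    (hpq : p ≤ q) (htpq : t ≤ p + q) :
    t ^ 2 * (p * q)⁻¹ ≤ t ^ (1 + α) * (2 * p ^ (-(1 + α))) := by
  have hq : 0 < q := hp.trans_le hpq
  have h1 : t ^ 2 = t ^ (1 + α) * t ^ (1 - α) := by
    rw [← Real.rpow_add ht, ← Real.rpow_natCast]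
    norm_num
  have h2 : t ^ (1 - α) ≤ 2 * q ^ (1 - α) := by
    calc t ^ (1 - α) ≤ (2 * q) ^ (1 - α) :=
          Real.rpow_le_rpow ht.le (by linarith) (by linarith)
      _ = 2 ^ (1 - α) * q ^ (1 - α) := Real.mul_rpow (by norm_num) hq.le
      _ ≤ 2 * q ^ (1 - α) := by
          refine mul_le_mul_of_nonneg_right ?_ (by positivity)
          calc (2 : ℝ) ^ (1 - α) ≤ 2 ^ (1 : ℝ) :=
                Real.rpow_le_rpow_of_exponent_le (by norm_num) (by linarith)
            _ = 2 := Real.rpow_one 2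
  have h3 : q ^ (1 - α) = q * q ^ (-α) := by
    rw [sub_eq_add_neg, Real.rpow_add hq, Real.rpow_one]
  have h4 : p ^ (-(1 + α)) = p⁻¹ * p ^ (-α) := by
    rw [neg_add, Real.rpow_add hp, Real.rpow_neg_one]
  have h5 : q ^ (-α) ≤ p ^ (-α) := Real.rpow_le_rpow_of_nonpos hp hpq (by linarith)
  rw [h1, mul_assoc]
  refine mul_le_mul_of_nonneg_left ?_ (by positivity)
  calc t ^ (1 - α) * (p * q)⁻¹ ≤ 2 * (q * q ^ (-α)) * (p * q)⁻¹ := by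
        rw [← h3]
        exact mul_le_mul_of_nonneg_right h2 (by positivity)
    _ = 2 * (p⁻¹ * q ^ (-α)) := by field_simp
    _ ≤ 2 * p ^ (-(1 + α)) := by
        rw [h4]
        have : 0 ≤ p⁻¹ := by positivity
        gcongr

lemma sq_div_mul_le {α : ℝ} (hα0 : 0 < α) (hα1 : α < 1) {t p q : ℝ} (ht : 0 ≤ t) (hp : 0 < p)
    (hq : 0 < q) (htpq : t ≤ p + q) :
    t ^ 2 * (p * q)⁻¹ ≤ t ^ (1 + α) * (2 * (p ^ (-(1 + α)) + q ^ (-(1 + α)))) := by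
  rcases ht.eq_or_lt with rfl | ht
  · rw [zero_pow two_ne_zero, zero_mul]
    positivity
  have hp' : 0 ≤ p ^ (-(1 + α)) := by positivity
  have hq' : 0 ≤ q ^ (-(1 + α)) := by positivity
  rcases le_total p q with h | h
  · refine (sq_div_mul_le_aux hα0 hα1 ht hp h htpq).trans ?_
    gcongr
    linarith
  · rw [mul_comm p q]
    refine (sq_div_mul_le_aux hα0 hα1 ht hq h (by linarith)).trans ?_
    gcongr
    linarith

/-- After translation by `z` the unit disk stays inside the disk of radius `2`, so the bound is
uniform in `z`. -/
lemma setIntegral_norm_sub_rpow_le {s : ℝ} (hs : s < 2) {z : ℂ} (hz : ‖z‖ ≤ 1) :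
    ∫ ζ in Metric.closedBall (0 : ℂ) 1, ‖ζ - z‖ ^ (-s) ≤
      ∫ ζ in Metric.closedBall (0 : ℂ) 2, ‖ζ‖ ^ (-s) := by
  have h := (measurePreserving_sub_right volume z).setIntegral_preimage_emb
    (Homeomorph.subRight z).measurableEmbedding (fun ζ : ℂ => ‖ζ‖ ^ (-s))
    (Metric.closedBall (0 : ℂ) 2)
  have hi := integrableOn_norm_sub_rpow hs (0 : ℂ) 2
  simp only [sub_zero] at hi
  rw [← h]
  refine setIntegral_mono_set ?_ (Eventually.of_forall fun ζ => by positivity) ?_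
  · exact ((measurePreserving_sub_right volume z).integrableOn_comp_preimage
      (Homeomorph.subRight z).measurableEmbedding).2 hi
  · refine LE.le.eventuallyLE fun ζ hζ => ?_
    simp only [Metric.mem_closedBall, dist_zero_right, mem_preimage] at hζ ⊢
    exact (norm_sub_le _ _).trans (by linarith)

/-- A function with compact support such that `|∂̄u| ≤ B |z|` agrees with a complex affine function
up to an error `O(B |z| ^ (1 + α))`. -/
theorem exists_norm_sub_affine_le {α : ℝ} (hα0 : 0 < α) (hα1 : α < 1) :
    ∃ C : ℝ, 0 < C ∧ ∀ (u : ℂ → ℂ) (B : ℝ), 0 ≤ B → Continuous u → (∀ z, 1 ≤ ‖z‖ → u z = 0) →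
      (∀ z : ℂ, z.im ≠ 0 → DifferentiableAt ℝ u z) →
      (∀ z : ℂ, z.im ≠ 0 → ‖dbar u z‖ ≤ B * ‖z‖) →
      ∃ a : ℂ, ∀ z : ℂ, ‖z‖ ≤ 1 → ‖u z - u 0 - a * z‖ ≤ C * B * ‖z‖ ^ (1 + α) := by
  set κ : ℝ := ∫ w : ℂ, ((1 + ‖w‖ ^ 2) ^ 2)⁻¹ with hκ
  have hκ0 : 0 < κ := integral_one_add_norm_sq_inv_sq_pos
  have hκ' : (κ : ℂ) ≠ 0 := Complex.ofReal_ne_zero.2 hκ0.ne'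
  set I₁ : ℝ := ∫ ζ in Metric.closedBall (0 : ℂ) 2, ‖ζ‖ ^ (-(1 + α)) with hI₁
  have hI₁0 : 0 ≤ I₁ := integral_nonneg fun ζ => by positivity
  refine ⟨(2 * κ)⁻¹ * (4 * I₁) + 1, by positivity, fun u B hB0 hu hsupp hd hB => ?_⟩
  have hB' : ∀ z : ℂ, z.im ≠ 0 → ‖dbar u z‖ ≤ B := by
    intro z hz
    rcases le_or_gt ‖z‖ 1 with h | h
    · exact (hB z hz).trans (mul_le_of_le_one_right hB0 h)
    · rw [dbar_eq_zero_of_one_lt_norm hsupp h, norm_zero]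
      exact hB0
  have hrep := integral_inv_sub_mul_dbar hu hsupp hd hB'
  rw [← hκ] at hrep
  have hint : ∀ z, Integrable fun ζ => (ζ - z)⁻¹ * dbar u ζ := fun z =>
    integrable_mul_dbar hsupp hB' (by fun_prop) (integrableOn_norm_sub_inv z 1) fun ζ => by
      rw [norm_inv]
  -- The kernel `ζ⁻²` alone is not integrable at `0`; the vanishing of `∂̄u` to first order there
  -- makes the product `O(|ζ|⁻¹)`.
  have hint2 : Integrable fun ζ => (ζ ^ 2)⁻¹ * dbar u ζ := by
    have hI : Integrable ((Metric.closedBall (0 : ℂ) 1).indicator fun ζ => ‖ζ - 0‖⁻¹ * B) :=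
      IntegrableOn.integrable_indicator ((integrableOn_norm_sub_inv 0 1).mul_const B)
        Metric.isClosed_closedBall.measurableSet
    refine hI.mono' (Measurable.mul (by fun_prop) (measurable_dbar u)).aestronglyMeasurable ?_
    filter_upwards [ae_im_ne_zero] with ζ hζ
    have hζ0 : ζ ≠ 0 := fun h => hζ (by simp [h])
    have hn := norm_pos_iff.2 hζ0
    by_cases h : ζ ∈ Metric.closedBall (0 : ℂ) 1
    · rw [indicator_of_mem h, norm_mul, norm_inv, norm_pow, sub_zero]
      refine (mul_le_mul_of_nonneg_left (hB ζ hζ) (by positivity)).trans (le_of_eq ?_)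
      field_simp
    · rw [indicator_of_notMem h, dbar_eq_zero_of_one_lt_norm hsupp (by simpa using h), mul_zero,
        norm_zero]
  -- The slope is the formal `z`-derivative at `0` of the Cauchy–Pompeiu integral.
  refine ⟨-(2 * κ : ℂ)⁻¹ * ∫ ζ, (ζ ^ 2)⁻¹ * dbar u ζ, fun z hz => ?_⟩
  have hmain : u z - u 0 - -(2 * κ : ℂ)⁻¹ * (∫ ζ, (ζ ^ 2)⁻¹ * dbar u ζ) * z =
      -(2 * κ : ℂ)⁻¹ * ∫ ζ, ((ζ - z)⁻¹ * dbar u ζ - (ζ - 0)⁻¹ * dbar u ζ -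
        z * ((ζ ^ 2)⁻¹ * dbar u ζ)) := by
    have hsub : Integrable fun ζ => (ζ - z)⁻¹ * dbar u ζ - (ζ - 0)⁻¹ * dbar u ζ :=
      (hint z).sub (hint 0)
    rw [integral_sub hsub (hint2.const_mul z), integral_sub (hint z) (hint 0),
      hrep, hrep, integral_const_mul]
    field_simp
    ring
  have hI : IntegrableOn (fun ζ : ℂ => B * ‖z‖ ^ (1 + α) *
      (2 * (‖ζ - 0‖ ^ (-(1 + α)) + ‖ζ - z‖ ^ (-(1 + α))))) (Metric.closedBall 0 1) :=
    (((integrableOn_norm_sub_rpow (by linarith) 0 1).add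
      (integrableOn_norm_sub_rpow (by linarith) z 1)).const_mul 2).const_mul _
  have hbound : ‖∫ ζ, ((ζ - z)⁻¹ * dbar u ζ - (ζ - 0)⁻¹ * dbar u ζ -
        z * ((ζ ^ 2)⁻¹ * dbar u ζ))‖ ≤ ∫ ζ, (Metric.closedBall (0 : ℂ) 1).indicator
          (fun ζ : ℂ => B * ‖z‖ ^ (1 + α) *
            (2 * (‖ζ - 0‖ ^ (-(1 + α)) + ‖ζ - z‖ ^ (-(1 + α))))) ζ := by
    refine norm_integral_le_of_norm_le
      (IntegrableOn.integrable_indicator hI Metric.isClosed_closedBall.measurableSet) ?_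
    have hne : ∀ᵐ ζ : ℂ, ζ ≠ z := by simp [ae_iff, measure_singleton]
    filter_upwards [ae_im_ne_zero, hne] with ζ hζ hζz
    have hζ0 : ζ ≠ 0 := fun h => hζ (by simp [h])
    have hζz' := sub_ne_zero.2 hζz
    have hn := norm_pos_iff.2 hζ0
    have hnz := norm_pos_iff.2 hζz'
    -- The remainder of the geometric expansion: `1/(ζ - z) - 1/ζ - z/ζ² = z²/(ζ²(ζ - z))`.
    have heq : (ζ - z)⁻¹ * dbar u ζ - (ζ - 0)⁻¹ * dbar u ζ - z * ((ζ ^ 2)⁻¹ * dbar u ζ) =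
        z ^ 2 * (ζ ^ 2 * (ζ - z))⁻¹ * dbar u ζ := by
      rw [sub_zero]
      field_simp
      ring
    rw [heq]
    by_cases h : ζ ∈ Metric.closedBall (0 : ℂ) 1
    · rw [indicator_of_mem h, norm_mul, norm_mul, norm_inv, norm_mul, norm_pow, norm_pow, sub_zero]
      have h1 : ‖z‖ ≤ ‖ζ‖ + ‖ζ - z‖ := by
        have := norm_sub_le ζ (ζ - z)
        simpa using this
      have h2 := sq_div_mul_le hα0 hα1 (norm_nonneg z) hn hnz h1
      calc ‖z‖ ^ 2 * (‖ζ‖ ^ 2 * ‖ζ - z‖)⁻¹ * ‖dbar u ζ‖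
          ≤ ‖z‖ ^ 2 * (‖ζ‖ ^ 2 * ‖ζ - z‖)⁻¹ * (B * ‖ζ‖) :=
            mul_le_mul_of_nonneg_left (hB ζ hζ) (by positivity)
        _ = B * (‖z‖ ^ 2 * (‖ζ‖ * ‖ζ - z‖)⁻¹) := by field_simp
        _ ≤ B * (‖z‖ ^ (1 + α) * (2 * (‖ζ‖ ^ (-(1 + α)) + ‖ζ - z‖ ^ (-(1 + α))))) :=
            mul_le_mul_of_nonneg_left h2 hB0
        _ = _ := by ring
    · rw [indicator_of_notMem h, dbar_eq_zero_of_one_lt_norm hsupp (by simpa using h), mul_zero,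
        norm_zero]
  rw [integral_indicator Metric.isClosed_closedBall.measurableSet, integral_const_mul,
    integral_const_mul, integral_add (integrableOn_norm_sub_rpow (by linarith) 0 1)
      (integrableOn_norm_sub_rpow (by linarith) z 1)] at hbound
  have hz0 := setIntegral_norm_sub_rpow_le (s := 1 + α) (by linarith) (z := 0) (by simp)
  have hzz := setIntegral_norm_sub_rpow_le (s := 1 + α) (by linarith) hz
  rw [hmain, norm_mul, norm_neg, norm_inv, norm_mul, Complex.norm_real, Complex.norm_ofNat,
    Real.norm_of_nonneg hκ0.le]
  have hBz : 0 ≤ B * ‖z‖ ^ (1 + α) := by positivity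
  calc (2 * κ)⁻¹ * _ ≤ (2 * κ)⁻¹ * (B * ‖z‖ ^ (1 + α) * (2 * (I₁ + I₁))) := by
        refine mul_le_mul_of_nonneg_left (hbound.trans ?_) (by positivity)
        gcongr
    _ ≤ _ := by
        linarith

/-- The bound on `∂̄X` is linear in `|z|` because `X` is constant near `0`; multiplying by `X` thus
preserves the hypothesis `|∂̄u| ≤ B|z|`. -/
lemma exists_cutoff : ∃ (X : ℂ → ℂ) (C : ℝ), 0 ≤ C ∧ Differentiable ℝ X ∧
    (∀ z, ‖X z‖ ≤ 1) ∧ (∀ z, ‖z‖ ≤ 1 / 2 → X z = 1) ∧ (∀ z, 3 / 4 ≤ ‖z‖ → X z = 0) ∧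
    ∀ z, ‖dbar X z‖ ≤ C * ‖z‖ := by
  let χ : ContDiffBump (0 : ℂ) := ⟨1 / 2, 3 / 4, by norm_num, by norm_num⟩
  let X : ℂ → ℂ := fun z => (χ z : ℂ)
  have hX : ContDiff ℝ 1 X := Complex.ofRealCLM.contDiff.comp χ.contDiff
  have h1 : ∀ z, ‖z‖ ≤ 1 / 2 → X z = 1 := fun z hz => by
    have := χ.one_of_mem_closedBall (x := z) (by simpa [χ] using hz)
    simp [X, this]
  have h0 : ∀ z, 3 / 4 ≤ ‖z‖ → X z = 0 := fun z hz => by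
    have := χ.zero_of_le_dist (x := z) (by simpa [χ] using hz)
    simp [X, this]
  have hc : Continuous (dbar X) := by
    have := hX.continuous_fderiv one_ne_zero
    unfold dbar
    fun_prop
  obtain ⟨C, hC⟩ := (isCompact_closedBall (0 : ℂ) 1).exists_bound_of_continuousOn hc.continuousOn
  have hC0 : 0 ≤ C := (norm_nonneg _).trans (hC 0 (by simp))
  refine ⟨X, 2 * C, by positivity, hX.differentiable one_ne_zero, fun z => ?_, h1, h0, fun z => ?_⟩
  · simp only [X, Complex.norm_real, Real.norm_eq_abs, abs_of_nonneg χ.nonneg]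
    exact χ.le_one
  · rcases lt_or_ge ‖z‖ (1 / 2) with hz | hz
    · have : X =ᶠ[𝓝 z] fun _ => 1 := by
        filter_upwards [(isOpen_lt continuous_norm continuous_const).mem_nhds hz] with w hw
        exact h1 w (le_of_lt hw)
      rw [this.dbar_eq, dbar_const, norm_zero]
      positivity
    rcases le_or_gt ‖z‖ 1 with hz1 | hz1
    · have := hC z (by simpa using hz1)
      nlinarith
    · rw [dbar_eq_zero_of_one_lt_norm (fun w hw => h0 w (by linarith)) hz1, norm_zero]
      positivity

/-- Localisation by a cutoff. The term `g ∂̄X` is why the same `B` must also bound `|g|`. -/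
theorem exists_norm_sub_affine_le_of_ball {α : ℝ} (hα0 : 0 < α) (hα1 : α < 1) :
    ∃ C : ℝ, 0 < C ∧ ∀ (g : ℂ → ℂ) (B : ℝ), 0 ≤ B → ContinuousOn g (Metric.ball 0 1) →
      (∀ z ∈ Metric.ball (0 : ℂ) 1, ‖g z‖ ≤ B) →
      (∀ z ∈ Metric.ball (0 : ℂ) 1, z.im ≠ 0 → DifferentiableAt ℝ g z ∧ ‖dbar g z‖ ≤ B * ‖z‖) →
      ∃ a : ℂ, ∀ z ∈ Metric.ball (0 : ℂ) (1 / 2),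
        ‖g z - g 0 - a * z‖ ≤ C * B * ‖z‖ ^ (1 + α) := by
  obtain ⟨C, hC0, hC⟩ := exists_norm_sub_affine_le hα0 hα1
  obtain ⟨X, C₁, hC₁, hXd, hX1, hXone, hXzero, hXdbar⟩ := exists_cutoff
  refine ⟨C * (1 + C₁), by positivity, fun g B hB0 hgc hgB hgd => ?_⟩
  have hzero : ∀ z : ℂ, 3 / 4 < ‖z‖ → (fun z => X z * g z) =ᶠ[𝓝 z] fun _ => 0 := fun z hz => by
    filter_upwards [(isOpen_lt continuous_const continuous_norm).mem_nhds hz] with w hw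
    rw [hXzero w (le_of_lt hw), zero_mul]
  have key := hC (fun z => X z * g z) (B * (1 + C₁)) (by positivity) ?_ ?_ ?_ ?_
  · obtain ⟨a, ha⟩ := key
    refine ⟨a, fun z hz => ?_⟩
    have hz' : ‖z‖ < 1 / 2 := by simpa using hz
    have := ha z (by linarith)
    rw [hXone z hz'.le, hXone 0 (by simp), one_mul, one_mul] at this
    exact this.trans (le_of_eq (by ring))
  · rw [continuous_iff_continuousAt]
    intro z
    rcases lt_or_ge ‖z‖ 1 with hz | hz
    · exact hXd.continuous.continuousAt.mul
        (hgc.continuousAt (Metric.isOpen_ball.mem_nhds (by simpa using hz)))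
    · exact continuousAt_const.congr (hzero z (by linarith)).symm
  · intro z hz
    simp only [hXzero z (by linarith), zero_mul]
  · intro z hz
    rcases lt_or_ge ‖z‖ 1 with h | h
    · exact (hXd z).mul (hgd z (by simpa using h) hz).1
    · exact (hzero z (by linarith)).differentiableAt_iff.2 (differentiableAt_const _)
  · intro z hz
    rcases lt_or_ge ‖z‖ 1 with h | h
    · have hzb : z ∈ Metric.ball (0 : ℂ) 1 := by simpa using h
      obtain ⟨h1, h2⟩ := hgd z hzb hz
      rw [dbar_mul (hXd z) h1]
      calc ‖X z * dbar g z + g z * dbar X z‖ ≤ ‖X z‖ * ‖dbar g z‖ + ‖g z‖ * ‖dbar X z‖ := by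
            refine (norm_add_le _ _).trans ?_
            rw [norm_mul, norm_mul]
        _ ≤ 1 * (B * ‖z‖) + B * (C₁ * ‖z‖) := by
            gcongr
            · exact hX1 z
            · exact hgB z hzb
            · exact hXdbar z
        _ = B * (1 + C₁) * ‖z‖ := by ring
    · rw [(hzero z (by linarith)).dbar_eq, dbar_const, norm_zero]
      positivity

lemma HasFDerivAt.comp_add_smul {F : Type*} [NormedAddCommGroup F] [NormedSpace ℝ F] {g : ℂ → F}
    {g' : ℂ →L[ℝ] F} {z₀ ζ : ℂ} {r : ℝ} (h : HasFDerivAt g g' (z₀ + r * ζ)) :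
    HasFDerivAt (fun ζ : ℂ => g (z₀ + r * ζ)) (r • g') ζ := by
  have h1 : HasFDerivAt (fun ζ : ℂ => z₀ + r * ζ) (r • ContinuousLinearMap.id ℝ ℂ) ζ := by
    have := ((hasFDerivAt_id (𝕜 := ℝ) ζ).const_smul r).const_add z₀
    refine this.congr_of_eventuallyEq (Eventually.of_forall fun w => ?_)
    simp
  have h2 := h.comp ζ h1
  refine h2.congr_fderiv ?_
  ext v
  simp

/-- If `∂̄g` is Lipschitz at `z₀`, then `g` agrees near `z₀` with an affine function up to an error
of order `1 + α`. The function need not be differentiable on the horizontal line through `z₀`. -/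
theorem exists_norm_sub_affine_le_of_dbar_sub_le {α : ℝ} (hα0 : 0 < α) (hα1 : α < 1) :
    ∃ C : ℝ, 0 < C ∧ ∀ (g : ℂ → ℂ) (z₀ k : ℂ) (r B : ℝ), 0 < r → 0 ≤ B →
      ContinuousOn g (Metric.ball z₀ r) → (∀ z ∈ Metric.ball z₀ r, ‖g z‖ ≤ B) → r * ‖k‖ ≤ B →
      (∀ z ∈ Metric.ball z₀ r, z.im ≠ z₀.im →
        DifferentiableAt ℝ g z ∧ r * ‖dbar g z - k‖ ≤ B * (‖z - z₀‖ / r)) →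
      ∃ T : ℂ →L[ℝ] ℂ, ∀ z ∈ Metric.ball z₀ (r / 2),
        ‖g z - g z₀ - T (z - z₀)‖ ≤ C * B * (‖z - z₀‖ / r) ^ (1 + α) := by
  obtain ⟨C, hC0, hC⟩ := exists_norm_sub_affine_le_of_ball hα0 hα1
  refine ⟨C * 2, by positivity, fun g z₀ k r B hr hB0 hgc hgB hk hgd => ?_⟩
  have hr' : (r : ℂ) ≠ 0 := Complex.ofReal_ne_zero.2 hr.ne'
  have hmaps : ∀ ζ ∈ Metric.ball (0 : ℂ) 1, z₀ + r * ζ ∈ Metric.ball z₀ r := fun ζ hζ => by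
    have hζ' : ‖ζ‖ < 1 := by simpa using hζ
    rw [Metric.mem_ball, dist_eq_norm, add_sub_cancel_left, norm_mul, Complex.norm_real,
      Real.norm_of_nonneg hr.le]
    exact mul_lt_of_lt_one_right hr hζ'
  have hcd : Differentiable ℝ fun ζ : ℂ => (starRingEnd ℂ) ζ := differentiable_conj
  -- The ball is rescaled to the unit ball, and since `dbar` of conjugation is `2`, subtracting
  -- `(rk/2) ζ̄` removes the constant `k`. This at most doubles the bound, because `r‖k‖ ≤ B`.
  have key := hC (fun ζ => g (z₀ + r * ζ) + -(r * k / 2) * (starRingEnd ℂ) ζ) (B * 2)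
    (by positivity) ?_ ?_ ?_
  · obtain ⟨a, ha⟩ := key
    -- Undoing the rescaling adds back the antilinear part `(k/2) z̄`, so `T` is only real linear.
    refine ⟨(a / r) • (ContinuousLinearMap.id ℝ ℂ) + (k / 2) • (Complex.conjCLE : ℂ →L[ℝ] ℂ),
      fun z hz => ?_⟩
    have hz' : ‖z - z₀‖ < r / 2 := by simpa [dist_eq_norm] using hz
    have hnorm : ‖(z - z₀) / r‖ = ‖z - z₀‖ / r := by
      rw [norm_div, Complex.norm_real, Real.norm_of_nonneg hr.le]
    have := ha ((z - z₀) / r) (by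
      rw [Metric.mem_ball, dist_zero_right, hnorm, div_lt_iff₀ hr]
      linarith)
    rw [hnorm] at this
    refine (le_of_eq ?_).trans (this.trans (le_of_eq (by ring)))
    congr 1
    have h1 : z₀ + r * ((z - z₀) / r) = z := by
      field_simp
      ring
    simp only [h1, mul_zero, add_zero, map_zero, map_div₀, Complex.conj_ofReal, add_apply,
      smul_apply, smul_eq_mul, ContinuousLinearMap.id_apply, ContinuousLinearEquiv.coe_coe,
      Complex.conjCLE_apply]
    field_simp
    ring
  · refine ContinuousOn.add (hgc.comp (by fun_prop) hmaps) ?_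
    exact (continuous_const.mul hcd.continuous).continuousOn
  · intro ζ hζ
    have hζ' : ‖ζ‖ < 1 := by simpa using hζ
    refine (norm_add_le _ _).trans ?_
    have h1 := hgB _ (hmaps ζ hζ)
    have h2 : ‖-(r * k / 2) * (starRingEnd ℂ) ζ‖ ≤ B := by
      rw [norm_mul, norm_neg, norm_div, norm_mul, Complex.norm_real, Real.norm_of_nonneg hr.le,
        RCLike.norm_conj, Complex.norm_ofNat]
      have : 0 ≤ r * ‖k‖ := by positivity
      nlinarith [norm_nonneg ζ]
    linarith
  · intro ζ hζ hζi
    have him : (z₀ + r * ζ).im ≠ z₀.im := by simp [hζi, hr.ne']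
    obtain ⟨h1, h2⟩ := hgd _ (hmaps ζ hζ) him
    have h3 := h1.hasFDerivAt.comp_add_smul
    refine ⟨h3.differentiableAt.add (by fun_prop), ?_⟩
    rw [dbar_add h3.differentiableAt (by fun_prop), h3.dbar_eq,
      dbar_mul (by fun_prop) (by fun_prop), dbar_const, dbar_conj]
    have h4 : (r • fderiv ℝ g (z₀ + r * ζ)) 1 + Complex.I * (r • fderiv ℝ g (z₀ + r * ζ)) Complex.I
        + (-(r * k / 2) * 2 + (starRingEnd ℂ) ζ * 0) = r * (dbar g (z₀ + r * ζ) - k) := by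
      simp only [dbar, smul_apply, Complex.real_smul]
      ring
    rw [h4, norm_mul, Complex.norm_real, Real.norm_of_nonneg hr.le]
    refine h2.trans ?_
    rw [add_sub_cancel_left, norm_mul, Complex.norm_real, Real.norm_of_nonneg hr.le,
      mul_div_cancel_left₀ _ hr.ne']
    nlinarith [norm_nonneg ζ]

/-! ### Schwarz reflection -/

lemma HasFDerivAt.conj_comp_conj {g : ℂ → ℂ} {g' : ℂ →L[ℝ] ℂ} {z : ℂ}
    (h : HasFDerivAt g g' ((starRingEnd ℂ) z)) :
    HasFDerivAt (fun w => (starRingEnd ℂ) (g ((starRingEnd ℂ) w)))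
      ((Complex.conjCLE : ℂ →L[ℝ] ℂ).comp (g'.comp (Complex.conjCLE : ℂ →L[ℝ] ℂ))) z := by
  have h1 : HasFDerivAt (fun w => (starRingEnd ℂ) w) (Complex.conjCLE : ℂ →L[ℝ] ℂ) z :=
    Complex.conjCLE.hasFDerivAt
  exact (Complex.conjCLE.hasFDerivAt (x := g ((starRingEnd ℂ) z))).comp z (h.comp z h1)

lemma HasFDerivAt.dbar_conj_comp_conj {g : ℂ → ℂ} {g' : ℂ →L[ℝ] ℂ} {z : ℂ}
    (h : HasFDerivAt g g' ((starRingEnd ℂ) z)) :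
    dbar (fun w => (starRingEnd ℂ) (g ((starRingEnd ℂ) w))) z =
      (starRingEnd ℂ) (dbar g ((starRingEnd ℂ) z)) := by
  rw [h.conj_comp_conj.dbar_eq, h.dbar_eq]
  simp

lemma mem_ball_conj_iff {z₀ z : ℂ} {r : ℝ} (hz₀ : z₀.im = 0) :
    (starRingEnd ℂ) z ∈ Metric.ball z₀ r ↔ z ∈ Metric.ball z₀ r := by
  have : (starRingEnd ℂ) z - z₀ = (starRingEnd ℂ) (z - z₀) := by
    rw [map_sub, Complex.conj_eq_iff_im.2 hz₀]
  rw [Metric.mem_ball, Metric.mem_ball, dist_eq_norm, dist_eq_norm, this, RCLike.norm_conj]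

/-- The boundary version of `exists_norm_sub_affine_le_of_dbar_sub_le`, for functions on a half
disk which are real on the real line; it follows by Schwarz reflection. -/
theorem exists_norm_sub_affine_le_of_real_boundary {α : ℝ} (hα0 : 0 < α) (hα1 : α < 1) :
    ∃ C : ℝ, 0 < C ∧ ∀ (g : ℂ → ℂ) (z₀ : ℂ) (r B : ℝ), 0 < r → 0 ≤ B → z₀.im = 0 →
      ContinuousOn g (Metric.ball z₀ r ∩ {z | 0 ≤ z.im}) →
      (∀ z ∈ Metric.ball z₀ r, 0 ≤ z.im → ‖g z‖ ≤ B) →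
      (∀ z ∈ Metric.ball z₀ r, z.im = 0 → (g z).im = 0) →
      (∀ z ∈ Metric.ball z₀ r, 0 < z.im →
        DifferentiableAt ℝ g z ∧ r * ‖dbar g z‖ ≤ B * (‖z - z₀‖ / r)) →
      ∃ T : ℂ →L[ℝ] ℂ, ∀ z ∈ Metric.ball z₀ (r / 2), 0 ≤ z.im →
        ‖g z - g z₀ - T (z - z₀)‖ ≤ C * B * (‖z - z₀‖ / r) ^ (1 + α) := by
  obtain ⟨C, hC0, hC⟩ := exists_norm_sub_affine_le_of_dbar_sub_le hα0 hα1
  refine ⟨C, hC0, fun g z₀ r B hr hB0 hz₀ hgc hgB hgr hgd => ?_⟩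
  set h : ℂ → ℂ := fun z => (starRingEnd ℂ) (g ((starRingEnd ℂ) z)) with hh
  set G : ℂ → ℂ := fun z => if 0 ≤ z.im then g z else h z with hG
  have hGup : ∀ z : ℂ, 0 ≤ z.im → G z = g z := fun z hz => if_pos hz
  have hGlo : ∀ z : ℂ, z.im < 0 → G z = h z := fun z hz => if_neg (not_le.2 hz)
  have key := hC G z₀ 0 r B hr hB0 ?_ ?_ ?_ ?_
  · obtain ⟨T, hT⟩ := key
    refine ⟨T, fun z hz hzi => ?_⟩
    have := hT z hz
    rwa [hGup z hzi, hGup z₀ hz₀.ge] at this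
  -- The two halves match on the real line because `g` is real there.
  · refine ContinuousOn.if ?_ ?_ ?_
    · rintro z ⟨hz, hzf⟩
      rw [Complex.frontier_setOfPred_le_im] at hzf
      have hzi : z.im = 0 := hzf
      simp only [hh]
      rw [Complex.conj_eq_iff_im.2 hzi, Complex.conj_eq_iff_im.2 (hgr z hz hzi)]
    · rwa [(isClosed_le continuous_const Complex.continuous_im).closure_eq]
    · have hset : {z : ℂ | ¬0 ≤ z.im} = {z : ℂ | z.im < 0} := by
        ext z
        simp
      rw [hset, Complex.closure_setOfPred_im_lt]
      refine differentiable_conj.continuous.comp_continuousOn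
        (hgc.comp differentiable_conj.continuous.continuousOn fun z hz => ?_)
      refine ⟨(mem_ball_conj_iff hz₀).2 hz.1, ?_⟩
      have : z.im ≤ 0 := hz.2
      simpa using this
  · intro z hz
    rcases le_or_gt 0 z.im with hzi | hzi
    · rw [hGup z hzi]
      exact hgB z hz hzi
    · rw [hGlo z hzi]
      simp only [hh, RCLike.norm_conj]
      exact hgB _ ((mem_ball_conj_iff hz₀).2 hz) (by simpa using hzi.le)
  · simpa using hB0
  · intro z hz hzi
    rw [hz₀] at hzi
    rw [sub_zero]
    rcases lt_or_gt_of_ne hzi with hlt | hgt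
    · have hev : G =ᶠ[𝓝 z] h := by
        filter_upwards [(isOpen_lt Complex.continuous_im continuous_const).mem_nhds hlt] with w hw
        exact hGlo w hw
      obtain ⟨h1, h2⟩ := hgd _ ((mem_ball_conj_iff hz₀).2 hz) (by simpa using hlt)
      refine ⟨hev.differentiableAt_iff.2 h1.hasFDerivAt.conj_comp_conj.differentiableAt, ?_⟩
      rw [hev.dbar_eq, h1.hasFDerivAt.dbar_conj_comp_conj, RCLike.norm_conj]
      have : (starRingEnd ℂ) z - z₀ = (starRingEnd ℂ) (z - z₀) := by
        rw [map_sub, Complex.conj_eq_iff_im.2 hz₀]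
      rwa [this, RCLike.norm_conj] at h2
    · have hev : G =ᶠ[𝓝 z] g := by
        filter_upwards [(isOpen_lt continuous_const Complex.continuous_im).mem_nhds hgt] with w hw
        exact hGup w (le_of_lt hw)
      obtain ⟨h1, h2⟩ := hgd z hz hgt
      exact ⟨hev.differentiableAt_iff.2 h1, by rwa [hev.dbar_eq]⟩

/-! ### Vector-valued maps and constant complex structures -/

/-- A remainder of order `1 + α` is `o(|z - z₀|)`, and derivatives are unique. This replaces the
linear map produced by the scalar expansions, which depends on the chosen functional, by the actual
derivative. -/
lemma HasFDerivWithinAt.eq_of_norm_sub_le {F : Type*} [NormedAddCommGroup F] [NormedSpace ℝ F]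
    {g : ℂ → F} {g' T : ℂ →L[ℝ] F} {S : Set ℂ} {z₀ : ℂ} {r C α : ℝ}
    (h : HasFDerivWithinAt g g' S z₀) (hu : UniqueDiffWithinAt ℝ S z₀) (hr : 0 < r) (hα : 0 < α)
    (hT : ∀ z ∈ Metric.ball z₀ r, z ∈ S →
      ‖g z - g z₀ - T (z - z₀)‖ ≤ C * (‖z - z₀‖ / r) ^ (1 + α)) : T = g' := by
  refine hu.eq (HasFDerivWithinAt.of_isLittleO ?_) h
  rw [Asymptotics.isLittleO_iff]
  intro c hc
  have h1 : Tendsto (fun z => C / r * (‖z - z₀‖ / r) ^ α) (𝓝[S] z₀) (𝓝 0) := by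
    have h2 : Continuous fun z => C / r * (‖z - z₀‖ / r) ^ α := by
      refine continuous_const.mul (Continuous.rpow_const (by fun_prop) fun z => Or.inr hα.le)
    have h3 := h2.tendsto z₀
    simp only [sub_self, norm_zero, zero_div, Real.zero_rpow hα.ne', mul_zero] at h3
    exact h3.mono_left nhdsWithin_le_nhds
  filter_upwards [h1.eventually (eventually_le_nhds hc), self_mem_nhdsWithin,
    mem_nhdsWithin_of_mem_nhds (Metric.ball_mem_nhds z₀ hr)] with z hz hzS hzb
  refine (hT z hzb hzS).trans ?_
  rcases eq_or_ne z z₀ with rfl | hne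
  · simp [Real.zero_rpow (by linarith : 1 + α ≠ 0)]
  have hpos : 0 < ‖z - z₀‖ := norm_pos_iff.2 (sub_ne_zero.2 hne)
  rw [Real.rpow_add (by positivity), Real.rpow_one]
  calc C * (‖z - z₀‖ / r * (‖z - z₀‖ / r) ^ α) = C / r * (‖z - z₀‖ / r) ^ α * ‖z - z₀‖ := by ring
    _ ≤ c * ‖z - z₀‖ := mul_le_mul_of_nonneg_right hz hpos.le

section ComplexStructure

variable {E : Type*} [NormedAddCommGroup E] [NormedSpace ℝ E]

/-- The functional `v ↦ m (P v) - i m (P (J v))`; it is complex linear for the complex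
structure `J`. -/
noncomputable def complexFunctional (J P : E →L[ℝ] E) (m : E →L[ℝ] ℝ) : E →L[ℝ] ℂ :=
  Complex.ofRealCLM.comp (m.comp P) - Complex.I • Complex.ofRealCLM.comp (m.comp (P.comp J))

lemma complexFunctional_apply (J P : E →L[ℝ] E) (m : E →L[ℝ] ℝ) (v : E) :
    complexFunctional J P m v = m (P v) - Complex.I * m (P (J v)) := rfl

lemma complexFunctional_re (J P : E →L[ℝ] E) (m : E →L[ℝ] ℝ) (v : E) :
    (complexFunctional J P m v).re = m (P v) := by
  simp [complexFunctional_apply]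

lemma complexFunctional_im (J P : E →L[ℝ] E) (m : E →L[ℝ] ℝ) (v : E) :
    (complexFunctional J P m v).im = -m (P (J v)) := by
  simp [complexFunctional_apply]

lemma complexFunctional_map (J P : E →L[ℝ] E) (m : E →L[ℝ] ℝ) (hJ : ∀ v, J (J v) = -v) (v : E) :
    complexFunctional J P m (J v) = Complex.I * complexFunctional J P m v := by
  rw [complexFunctional_apply, complexFunctional_apply, hJ, map_neg, map_neg]
  push_cast
  linear_combination (m (P (J v)) : ℂ) * Complex.I_mul_I

lemma norm_complexFunctional_le {J P : E →L[ℝ] E} {Λ : ℝ} (hΛ : 0 ≤ Λ)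
    (hJ : ∀ v, ‖J v‖ ≤ Λ * ‖v‖) (hP : ∀ v, ‖P v‖ ≤ Λ * ‖v‖) (m : E →L[ℝ] ℝ) (v : E) :
    ‖complexFunctional J P m v‖ ≤ ‖m‖ * (Λ * (1 + Λ)) * ‖v‖ := by
  have h1 : ‖m (P v)‖ ≤ ‖m‖ * (Λ * ‖v‖) :=
    (m.le_opNorm _).trans (mul_le_mul_of_nonneg_left (hP v) (norm_nonneg _))
  have h2 : ‖m (P (J v))‖ ≤ ‖m‖ * (Λ * (Λ * ‖v‖)) :=
    (m.le_opNorm _).trans (mul_le_mul_of_nonneg_left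
      ((hP _).trans (mul_le_mul_of_nonneg_left (hJ v) hΛ)) (norm_nonneg _))
  rw [complexFunctional_apply]
  refine (norm_sub_le _ _).trans ?_
  rw [norm_mul, Complex.norm_I, one_mul, Complex.norm_real, Complex.norm_real]
  linarith

lemma HasFDerivAt.dbar_complexFunctional {J P : E →L[ℝ] E} (hJ : ∀ v, J (J v) = -v)
    (m : E →L[ℝ] ℝ) {F : ℂ → E} {F' : ℂ →L[ℝ] E} {z : ℂ} (h : HasFDerivAt F F' z) :
    dbar (fun w => complexFunctional J P m (F w)) z =
      complexFunctional J P m (F' 1 + J (F' Complex.I)) := by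
  have h1 := (complexFunctional J P m).hasFDerivAt (x := F z) |>.comp z h
  refine h1.dbar_eq.trans ?_
  rw [map_add, complexFunctional_map J P m hJ]
  rfl

/-- Interior expansion of a map whose antiholomorphic derivative with respect to a constant complex
structure is Lipschitz at `z₀`. -/
theorem exists_norm_sub_fderiv_le {α : ℝ} (hα0 : 0 < α) (hα1 : α < 1) {Λ : ℝ} (hΛ : 1 ≤ Λ) :
    ∃ C : ℝ, 0 < C ∧ ∀ {E : Type*} [NormedAddCommGroup E] [NormedSpace ℝ E] (J : E →L[ℝ] E)
      (F : ℂ → E) (F' : ℂ → ℂ →L[ℝ] E) (z₀ : ℂ) (k : E) (r B : ℝ), 0 < r → 0 ≤ B →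
      (∀ v, J (J v) = -v) → (∀ v, ‖J v‖ ≤ Λ * ‖v‖) →
      (∀ z ∈ Metric.ball z₀ r, HasFDerivAt F (F' z) z) → (∀ z ∈ Metric.ball z₀ r, ‖F z‖ ≤ B) →
      r * ‖k‖ ≤ B →
      (∀ z ∈ Metric.ball z₀ r, r * ‖F' z 1 + J (F' z Complex.I) - k‖ ≤ B * (‖z - z₀‖ / r)) →
      ∀ z ∈ Metric.ball z₀ (r / 2),
        ‖F z - F z₀ - F' z₀ (z - z₀)‖ ≤ C * B * (‖z - z₀‖ / r) ^ (1 + α) := by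
  obtain ⟨C, hC0, hC⟩ := exists_norm_sub_affine_le_of_dbar_sub_le hα0 hα1
  have hΛ0 : 0 ≤ Λ := by linarith
  refine ⟨C * (Λ * (1 + Λ)), by positivity,
    fun {E} _ _ J F F' z₀ k r B hr hB0 hJJ hJ hF hFB hk hFd z hz => ?_⟩
  -- By duality it is enough to test against real functionals `m`; each is the real part of a
  -- `J`-linear functional `l`, to which the scalar theorem applies. The constant therefore does not
  -- see the dimension.
  refine NormedSpace.norm_le_dual_bound ℝ _ (by positivity) fun m => ?_
  set l := complexFunctional J (ContinuousLinearMap.id ℝ E) m with hl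
  have hln : ∀ v, ‖l v‖ ≤ ‖m‖ * (Λ * (1 + Λ)) * ‖v‖ :=
    norm_complexFunctional_le hΛ0 hJ (fun v => by
      simpa using le_mul_of_one_le_left (norm_nonneg v) hΛ) m
  have hlF : ∀ z ∈ Metric.ball z₀ r, HasFDerivAt (fun w => l (F w)) (l.comp (F' z)) z :=
    fun z hz => l.hasFDerivAt.comp z (hF z hz)
  have hK : 0 ≤ ‖m‖ * (Λ * (1 + Λ)) := by positivity
  obtain ⟨T, hT⟩ := hC (fun w => l (F w)) z₀ (l k) r (‖m‖ * (Λ * (1 + Λ)) * B) hr (by positivity)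
    (fun z hz => (hlF z hz).continuousAt.continuousWithinAt)
    (fun z hz => (hln _).trans (mul_le_mul_of_nonneg_left (hFB z hz) hK))
    (by
      calc r * ‖l k‖ ≤ r * (‖m‖ * (Λ * (1 + Λ)) * ‖k‖) := by gcongr; exact hln k
        _ = ‖m‖ * (Λ * (1 + Λ)) * (r * ‖k‖) := by ring
        _ ≤ _ := mul_le_mul_of_nonneg_left hk hK)
    (fun z hz _ => ⟨(hlF z hz).differentiableAt, by
      rw [(hF z hz).dbar_complexFunctional hJJ, ← hl, ← map_sub]
      calc r * ‖l (F' z 1 + J (F' z Complex.I) - k)‖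
          ≤ r * (‖m‖ * (Λ * (1 + Λ)) * ‖F' z 1 + J (F' z Complex.I) - k‖) := by
            gcongr
            exact hln _
        _ = ‖m‖ * (Λ * (1 + Λ)) * (r * ‖F' z 1 + J (F' z Complex.I) - k‖) := by ring
        _ ≤ ‖m‖ * (Λ * (1 + Λ)) * (B * (‖z - z₀‖ / r)) :=
            mul_le_mul_of_nonneg_left (hFd z hz) hK
        _ = _ := by ring⟩)
  have hTeq : T = l.comp (F' z₀) :=
    (hlF z₀ (Metric.mem_ball_self hr)).hasFDerivWithinAt.eq_of_norm_sub_le (S := univ)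
      -- The factor `(1/2)^(1+α)` converts from the scale `r` to the radius `r/2` of the ball where
      -- the expansion holds.
      (C := C * (‖m‖ * (Λ * (1 + Λ)) * B) * (1 / 2) ^ (1 + α)) (r := r / 2)
      uniqueDiffWithinAt_univ (by positivity) hα0 fun z hz _ => by
        refine (hT z hz).trans (le_of_eq ?_)
        rw [mul_assoc _ ((1 / 2 : ℝ) ^ (1 + α)), ← Real.mul_rpow (by norm_num) (by positivity)]
        congr 2
        field_simp
  have h1 := hT z hz
  rw [hTeq, ContinuousLinearMap.comp_apply, ← map_sub, ← map_sub] at h1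
  have h2 : ‖m (F z - F z₀ - F' z₀ (z - z₀))‖ ≤ ‖l (F z - F z₀ - F' z₀ (z - z₀))‖ := by
    have := Complex.abs_re_le_norm (l (F z - F z₀ - F' z₀ (z - z₀)))
    rwa [hl, complexFunctional_re] at this
  exact h2.trans (h1.trans (le_of_eq (by ring)))

/-- Boundary expansion of a map on a half disk with values in the totally real subspace `W` on the
real line, where `P` is the projection to `W` along `J W`. -/
theorem exists_norm_sub_fderivWithin_le {α : ℝ} (hα0 : 0 < α) (hα1 : α < 1) {Λ : ℝ} (hΛ : 1 ≤ Λ) :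
    ∃ C : ℝ, 0 < C ∧ ∀ {E : Type*} [NormedAddCommGroup E] [NormedSpace ℝ E] (J P : E →L[ℝ] E)
      (W : Submodule ℝ E) (F : ℂ → E) (F' : ℂ → ℂ →L[ℝ] E) (S : Set ℂ) (z₀ : ℂ) (r B : ℝ),
      0 < r → 0 ≤ B → z₀.im = 0 →
      (∀ v, J (J v) = -v) → (∀ v, ‖J v‖ ≤ Λ * ‖v‖) → (∀ v, ‖P v‖ ≤ Λ * ‖v‖) →
      (∀ w ∈ W, P (J w) = 0) → (∀ v, v = P v - J (P (J v))) →
      (∀ z ∈ S, 0 ≤ z.im) → UniqueDiffWithinAt ℝ S z₀ → HasFDerivWithinAt F (F' z₀) S z₀ →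
      ContinuousOn F (Metric.ball z₀ r ∩ {z | 0 ≤ z.im}) →
      (∀ z ∈ Metric.ball z₀ r, 0 < z.im → HasFDerivAt F (F' z) z) →
      (∀ z ∈ Metric.ball z₀ r, 0 ≤ z.im → ‖F z‖ ≤ B) →
      (∀ z ∈ Metric.ball z₀ r, z.im = 0 → F z ∈ W) →
      (∀ z ∈ Metric.ball z₀ r, 0 < z.im →
        r * ‖F' z 1 + J (F' z Complex.I)‖ ≤ B * (‖z - z₀‖ / r)) →
      ∀ z ∈ Metric.ball z₀ (r / 2), 0 ≤ z.im →
        ‖F z - F z₀ - F' z₀ (z - z₀)‖ ≤ C * B * (‖z - z₀‖ / r) ^ (1 + α) := by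
  obtain ⟨C, hC0, hC⟩ := exists_norm_sub_affine_le_of_real_boundary hα0 hα1
  have hΛ0 : 0 ≤ Λ := by linarith
  refine ⟨(1 + Λ) * (C * (Λ * (1 + Λ))), by positivity,
    fun {E} _ _ J P W F F' S z₀ r B hr hB0 hz₀ hJJ hJ hP hPJ hPsum hS hSu hFS hFc hF hFB hFW hFd
      z hz hzi => ?_⟩
  have key : ∀ m : StrongDual ℝ E, ‖complexFunctional J P m (F z - F z₀ - F' z₀ (z - z₀))‖ ≤
      C * (Λ * (1 + Λ)) * B * (‖z - z₀‖ / r) ^ (1 + α) * ‖m‖ := by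
    intro m
    set l := complexFunctional J P m with hl
    have hln : ∀ v, ‖l v‖ ≤ ‖m‖ * (Λ * (1 + Λ)) * ‖v‖ := norm_complexFunctional_le hΛ0 hJ hP m
    have hlF : ∀ z ∈ Metric.ball z₀ r, 0 < z.im →
        HasFDerivAt (fun w => l (F w)) (l.comp (F' z)) z :=
      fun z hz hzi => l.hasFDerivAt.comp z (hF z hz hzi)
    have hK : 0 ≤ ‖m‖ * (Λ * (1 + Λ)) := by positivity
    obtain ⟨T, hT⟩ := hC (fun w => l (F w)) z₀ r (‖m‖ * (Λ * (1 + Λ)) * B) hr (by positivity) hz₀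
      (l.continuous.comp_continuousOn hFc)
      (fun z hz hzi => (hln _).trans (mul_le_mul_of_nonneg_left (hFB z hz hzi) hK))
      -- The imaginary part of `l` is `-m ∘ P ∘ J`, which vanishes on `W`.
      (fun z hz hzi => by rw [hl, complexFunctional_im, hPJ _ (hFW z hz hzi), map_zero, neg_zero])
      (fun z hz hzi => ⟨(hlF z hz hzi).differentiableAt, by
        rw [(hF z hz hzi).dbar_complexFunctional hJJ, ← hl]
        calc r * ‖l (F' z 1 + J (F' z Complex.I))‖
            ≤ r * (‖m‖ * (Λ * (1 + Λ)) * ‖F' z 1 + J (F' z Complex.I)‖) := by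
              gcongr
              exact hln _
          _ = ‖m‖ * (Λ * (1 + Λ)) * (r * ‖F' z 1 + J (F' z Complex.I)‖) := by ring
          _ ≤ ‖m‖ * (Λ * (1 + Λ)) * (B * (‖z - z₀‖ / r)) :=
              mul_le_mul_of_nonneg_left (hFd z hz hzi) hK
          _ = _ := by ring⟩)
    have hTeq : T = l.comp (F' z₀) :=
      (l.hasFDerivAt.comp_hasFDerivWithinAt z₀ hFS).eq_of_norm_sub_le
        (C := C * (‖m‖ * (Λ * (1 + Λ)) * B) * (1 / 2) ^ (1 + α)) (r := r / 2)
        hSu (by positivity) hα0 fun z hz hzS => by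
          refine (hT z hz (hS z hzS)).trans (le_of_eq ?_)
          rw [mul_assoc _ ((1 / 2 : ℝ) ^ (1 + α)), ← Real.mul_rpow (by norm_num) (by positivity)]
          congr 2
          field_simp
    have h1 := hT z hz hzi
    rw [hTeq, ContinuousLinearMap.comp_apply, ← map_sub, ← map_sub] at h1
    exact h1.trans (le_of_eq (by ring))
  -- Real and imaginary parts of the functionals control `P x` and `P (J x)`, from which `x` is
  -- recovered.
  set x := F z - F z₀ - F' z₀ (z - z₀) with hx
  have hM : 0 ≤ C * (Λ * (1 + Λ)) * B * (‖z - z₀‖ / r) ^ (1 + α) := by positivity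
  have h1 : ‖P x‖ ≤ C * (Λ * (1 + Λ)) * B * (‖z - z₀‖ / r) ^ (1 + α) := by
    refine NormedSpace.norm_le_dual_bound ℝ _ hM fun m => le_trans ?_ (key m)
    have := Complex.abs_re_le_norm (complexFunctional J P m x)
    rwa [complexFunctional_re] at this
  have h2 : ‖P (J x)‖ ≤ C * (Λ * (1 + Λ)) * B * (‖z - z₀‖ / r) ^ (1 + α) := by
    refine NormedSpace.norm_le_dual_bound ℝ _ hM fun m => le_trans ?_ (key m)
    have := Complex.abs_im_le_norm (complexFunctional J P m x)
    rwa [complexFunctional_im, abs_neg] at this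
  calc ‖x‖ = ‖P x - J (P (J x))‖ := congrArg _ (hPsum x)
    _ ≤ ‖P x‖ + Λ * ‖P (J x)‖ := (norm_sub_le _ _).trans (by gcongr; exact hJ _)
    _ ≤ C * (Λ * (1 + Λ)) * B * (‖z - z₀‖ / r) ^ (1 + α) +
        Λ * (C * (Λ * (1 + Λ)) * B * (‖z - z₀‖ / r) ^ (1 + α)) := by gcongr
    _ = _ := by ring

end ComplexStructure

/-! ### Totally real subspaces and straightening of `L` -/

lemma le_finrank_flatSubspace (n : ℕ) : n ≤ Module.finrank ℝ (flatSubspace n) := by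
  let g : (Fin n → ℝ) →ₗ[ℝ] flatSubspace n :=
    { toFun := fun x => ⟨WithLp.toLp 2 fun i : Fin (2 * n) => if h : i.val < n then x ⟨i, h⟩ else 0,
        fun i hi => by simp [not_lt.2 hi]⟩
      map_add' := fun x y => by
        ext i
        by_cases h : i.val < n <;> simp [h]
      map_smul' := fun c x => by
        ext i
        by_cases h : i.val < n <;> simp [h] }
  have hg : Function.Injective g := by
    intro x y hxy
    funext i
    have h := congrArg (fun v : flatSubspace n => (v : RSpace n) ⟨i, by omega⟩) hxy
    simpa [g] using h
  simpa using LinearMap.finrank_le_finrank_of_injective hg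

/-- The projection to a maximal totally real subspace `W` along `J W`, with the bound that follows
from uniform total reality. -/
lemma exists_totallyReal_projection {E : Type*} [NormedAddCommGroup E] [NormedSpace ℝ E]
    [FiniteDimensional ℝ E] {J : E →L[ℝ] E} {W : Submodule ℝ E} {Λ : ℝ} (hΛ : 1 ≤ Λ)
    (hJJ : ∀ v, J (J v) = -v) (hJ : ∀ v, ‖J v‖ ≤ Λ * ‖v‖)
    (hdim : Module.finrank ℝ E ≤ 2 * Module.finrank ℝ W)
    (hW : ∀ u ∈ W, ∀ v ∈ W, ‖v‖ ≤ Λ * ‖u + J v‖) :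
    ∃ P : E →L[ℝ] E, (∀ v, ‖P v‖ ≤ (1 + Λ ^ 2) * ‖v‖) ∧ (∀ w ∈ W, P (J w) = 0) ∧
      ∀ v, v = P v - J (P (J v)) := by
  have hinj : Function.Injective J := fun x y hxy => by
    have := congrArg J hxy
    rwa [hJJ, hJJ, neg_inj] at this
  have hdisj : Disjoint W (W.map (J : E →ₗ[ℝ] E)) := by
    rw [Submodule.disjoint_def]
    rintro x hx ⟨w, hw, rfl⟩
    -- For `x = J w` in `W`, the choice `u = -x` makes the right-hand side of the uniform bound
    -- vanish.
    have h := hW _ (W.neg_mem hx) w hw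
    simp only [ContinuousLinearMap.coe_coe, neg_add_cancel, norm_zero, mul_zero] at h
    rw [norm_le_zero_iff.1 h, map_zero]
  have hc : IsCompl W (W.map (J : E →ₗ[ℝ] E)) := by
    refine (Submodule.isCompl_iff_disjoint _ _ ?_).2 hdisj
    have := (Submodule.equivMapOfInjective (J : E →ₗ[ℝ] E) hinj W).finrank_eq
    omega
  let P : E →L[ℝ] E := LinearMap.toContinuousLinearMap (W.projection _ hc)
  have hPW : ∀ w ∈ W, P w = w := fun w hw => Submodule.projection_apply_of_mem_left hc hw
  have hPJ : ∀ w ∈ W, P (J w) = 0 := fun w hw =>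
    Submodule.projection_apply_of_mem_right hc ⟨w, hw, rfl⟩
  have hdec : ∀ v, ∃ u ∈ W, ∃ w ∈ W, v = u + J w := fun v => by
    have hv : v ∈ W ⊔ W.map (J : E →ₗ[ℝ] E) := by
      rw [hc.sup_eq_top]
      trivial
    obtain ⟨u, hu, y, ⟨w, hw, rfl⟩, rfl⟩ := Submodule.mem_sup.1 hv
    exact ⟨u, hu, w, hw, rfl⟩
  refine ⟨P, fun v => ?_, hPJ, fun v => ?_⟩
  · obtain ⟨u, hu, w, hw, rfl⟩ := hdec v
    rw [map_add, hPW u hu, hPJ w hw, add_zero]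
    have h1 := hW u hu w hw
    have h2 : ‖u‖ ≤ ‖u + J w‖ + ‖J w‖ := by
      simpa using norm_sub_le (u + J w) (J w)
    have h3 := hJ w
    nlinarith
  -- For `v = u + J w` one has `P v = u`, while `J v = J u - w` gives `P (J v) = -w`.
  · obtain ⟨u, hu, w, hw, rfl⟩ := hdec v
    simp only [map_add, hPW u hu, hPJ w hw, hPJ u hu, hJJ, map_neg, hPW w hw, add_zero, zero_add,
      sub_neg_eq_add]

/-- The velocity is realised by the preimage under the chart of the straight line through `φ p` with
direction `T e`, which stays in the flat subspace. -/
lemma HasFDerivAt.mem_tangentVectors {n : ℕ} {L : Set (RSpace n)}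
    {φ : OpenPartialHomeomorph (RSpace n) (RSpace n)} (hφ : IsSliceChart L φ) {p : RSpace n}
    (hp : p ∈ φ.source) (hpL : p ∈ L) {T : RSpace n ≃L[ℝ] RSpace n}
    (hT : HasFDerivAt φ (T : RSpace n →L[ℝ] RSpace n) p) {e : RSpace n}
    (he : T e ∈ flatSubspace n) : e ∈ tangentVectors L p := by
  have hφp : φ p ∈ flatSubspace n := (hφ.mem_iff p hp).1 hpL
  have hline : HasDerivAt (fun t : ℝ => φ p + t • T e) (T e) 0 := by
    simpa using ((hasDerivAt_id (0 : ℝ)).smul_const (T e)).const_add (φ p)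
  refine ⟨fun t => φ.symm (φ p + t • T e), by simp [φ.left_inv hp], ?_, ?_⟩
  · have htgt : ∀ᶠ t in 𝓝 (0 : ℝ), φ p + t • T e ∈ φ.target := by
      refine hline.continuousAt.eventually_mem (φ.open_target.mem_nhds ?_)
      simpa using φ.map_source hp
    filter_upwards [htgt] with t ht
    rw [hφ.mem_iff _ (φ.map_target ht), φ.right_inv ht]
    exact (flatSubspace n).add_mem hφp ((flatSubspace n).smul_mem t he)
  · have hsymm : HasFDerivAt φ.symm (T.symm : RSpace n →L[ℝ] RSpace n) (φ p + (0 : ℝ) • T e) := by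
      rw [zero_smul, add_zero]
      refine φ.hasFDerivAt_symm (φ.map_source hp) ?_
      rwa [φ.left_inv hp]
    refine (hsymm.comp_hasDerivAt (0 : ℝ) hline).congr_deriv ?_
    simp

lemma HasBoundedGeometryOn.mono {n : ℕ} {J : RSpace n → RSpace n →L[ℝ] RSpace n}
    {L K : Set (RSpace n)} {ρ Λ Λ' : ℝ} (h : HasBoundedGeometryOn J L K ρ Λ) (hΛ : Λ ≤ Λ') :
    HasBoundedGeometryOn J L K ρ Λ' where
  norm_le w hw v := (h.norm_le w hw v).trans (by gcongr)
  norm_fderiv_le w hw u v := (h.norm_fderiv_le w hw u v).trans (by gcongr)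
  exists_chart p hp := by
    obtain ⟨φ, h1, h2, h3⟩ := h.exists_chart p hp
    refine ⟨φ, h1, h2, fun w hw => ⟨fun v => ⟨?_, ?_⟩, fun u v => ?_⟩⟩
    · exact ((h3 w hw).1 v).1.trans (by gcongr)
    · exact ((h3 w hw).1 v).2.trans (by gcongr)
    · exact ((h3 w hw).2 u v).trans (by gcongr)
  uniformly_totallyReal p hp u hu v hv :=
    (h.uniformly_totallyReal p hp u hu v hv).trans (by gcongr)

/-- Near each point `p` of `L ∩ K` there is a map which is tangent to the identity at `p`, and
carries `L` to a linear subspace `W` that is totally real for `J p`. -/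
theorem HasBoundedGeometryOn.exists_straightening {n : ℕ}
    {J : RSpace n → RSpace n →L[ℝ] RSpace n} {L K : Set (RSpace n)} {ρ Λ : ℝ} (hρ : 0 < ρ)
    (hΛ : 1 ≤ Λ) (h : HasBoundedGeometryOn J L K ρ Λ) (hJ : IsAlmostComplexStructure J)
    {p : RSpace n} (hp : p ∈ L ∩ K) :
    ∃ (ψ : RSpace n → RSpace n) (ψ' : RSpace n → RSpace n →L[ℝ] RSpace n)
      (W : Submodule ℝ (RSpace n)) (P : RSpace n →L[ℝ] RSpace n),
      ψ p = 0 ∧ (∀ w ∈ Metric.ball p ρ, HasFDerivAt ψ (ψ' w) w) ∧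
      (∀ w ∈ Metric.ball p ρ, ∀ v, ‖ψ' w v - v‖ ≤ Λ ^ 2 * ‖w - p‖ * ‖v‖) ∧
      (∀ w ∈ Metric.ball p ρ, w ∈ L → ψ w ∈ W) ∧
      (∀ v, ‖P v‖ ≤ (1 + Λ ^ 2) * ‖v‖) ∧ (∀ w ∈ W, P (J p w) = 0) ∧
      ∀ v, v = P v - J p (P (J p v)) := by
  obtain ⟨φ, hφ, hball, hbd⟩ := h.exists_chart p hp
  have hpb : p ∈ Metric.ball p ρ := Metric.mem_ball_self hρ
  have hinj : Function.Injective (fderiv ℝ φ p) := by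
    rw [injective_iff_map_eq_zero]
    intro v hv
    have := ((hbd p hpb).1 v).2
    rw [hv, norm_zero, mul_zero] at this
    exact norm_le_zero_iff.1 this
  let T : RSpace n ≃L[ℝ] RSpace n :=
    (LinearEquiv.ofInjectiveEndo (fderiv ℝ φ p : RSpace n →ₗ[ℝ] RSpace n)
      hinj).toContinuousLinearEquiv
  have hT : (T : RSpace n →L[ℝ] RSpace n) = fderiv ℝ φ p := by
    ext v
    rfl
  have hTv : ∀ v, T v = fderiv ℝ φ p v := fun v => rfl
  have hTsymm : ∀ v, ‖T.symm v‖ ≤ Λ * ‖v‖ := fun v => by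
    have := ((hbd p hpb).1 (T.symm v)).2
    rwa [← hTv, T.apply_symm_apply] at this
  have hcd : ∀ w ∈ Metric.ball p ρ, ContDiffAt ℝ ∞ φ w := fun w hw =>
    hφ.smooth.contDiffAt (φ.open_source.mem_nhds (hball hw))
  have hd : ∀ w ∈ Metric.ball p ρ, HasFDerivAt φ (fderiv ℝ φ w) w := fun w hw =>
    ((hcd w hw).differentiableAt (by simp)).hasFDerivAt
  have hdd : ∀ w ∈ Metric.ball p ρ, DifferentiableAt ℝ (fderiv ℝ φ) w := fun w hw =>
    ((hcd w hw).fderiv_right (m := 1) (by norm_cast)).differentiableAt one_ne_zero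
  have hlip : ∀ w ∈ Metric.ball p ρ, ‖fderiv ℝ φ w - fderiv ℝ φ p‖ ≤ Λ * ‖w - p‖ := fun w hw => by
    refine (convex_ball p ρ).norm_image_sub_le_of_norm_fderiv_le hdd (fun x hx => ?_) hpb hw
    refine ContinuousLinearMap.opNorm_le_bound _ (by linarith) fun u => ?_
    exact ContinuousLinearMap.opNorm_le_bound _ (by positivity) fun v => (hbd x hx).2 u v
  let W : Submodule ℝ (RSpace n) :=
    (flatSubspace n).map (T.symm.toLinearEquiv : RSpace n →ₗ[ℝ] RSpace n)
  have hWT : ∀ w ∈ W, T w ∈ flatSubspace n := by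
    rintro w ⟨e, he, rfl⟩
    simpa using he
  have hWtan : ∀ w ∈ W, w ∈ tangentVectors L p := fun w hw =>
    HasFDerivAt.mem_tangentVectors hφ (hball hpb) hp.1 (hT ▸ hd p hpb) (hWT w hw)
  have hdim : Module.finrank ℝ (RSpace n) ≤ 2 * Module.finrank ℝ W := by
    have h1 : Module.finrank ℝ W = Module.finrank ℝ (flatSubspace n) :=
      LinearEquiv.finrank_map_eq T.symm.toLinearEquiv (flatSubspace n)
    rw [h1, finrank_euclideanSpace_fin]
    have := le_finrank_flatSubspace n
    omega
  obtain ⟨P, hP1, hP2, hP3⟩ := exists_totallyReal_projection hΛ (hJ.sq_eq_neg p)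
    (h.norm_le p hp.2) hdim
    fun u hu v hv => h.uniformly_totallyReal p hp u (hWtan u hu) v (hWtan v hv)
  -- The chart is normalised by the inverse of its derivative at `p`. Its derivative then differs
  -- from the identity by at most `Λ` (inverse) times `Λ‖w - p‖` (second derivative).
  refine ⟨fun w => T.symm (φ w - φ p),
    fun w => (T.symm : RSpace n →L[ℝ] RSpace n).comp (fderiv ℝ φ w), W, P, by simp,
    fun w hw => ?_, fun w hw v => ?_, fun w hw hwL => ?_, hP1, hP2, hP3⟩
  · exact (T.symm : RSpace n →L[ℝ] RSpace n).hasFDerivAt.comp w ((hd w hw).sub_const _)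
  · have h1 : (T.symm : RSpace n →L[ℝ] RSpace n).comp (fderiv ℝ φ w) v - v =
        T.symm ((fderiv ℝ φ w - fderiv ℝ φ p) v) := by
      rw [sub_apply, map_sub, ← hTv v, T.symm_apply_apply]
      rfl
    rw [h1]
    calc ‖T.symm ((fderiv ℝ φ w - fderiv ℝ φ p) v)‖
        ≤ Λ * ‖(fderiv ℝ φ w - fderiv ℝ φ p) v‖ := hTsymm _
      _ ≤ Λ * (Λ * ‖w - p‖ * ‖v‖) := by
          gcongr
          exact ContinuousLinearMap.le_of_opNorm_le _ (hlip w hw) v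
      _ = _ := by ring
  · refine ⟨φ w - φ p, ?_, rfl⟩
    exact (flatSubspace n).sub_mem ((hφ.mem_iff w (hball hw)).1 hwL)
      ((hφ.mem_iff p (hball hpb)).1 hp.1)

/-! ### First estimates for pseudo-holomorphic half disks -/

lemma convex_halfDisk : Convex ℝ halfDisk := by
  have h : halfDisk = Metric.ball 0 1 ∩ {z : ℂ | 0 ≤ z.im} := by
    ext z
    simp [halfDisk]
  rw [h]
  exact (convex_ball 0 1).inter (convex_halfSpace_im_ge 0)

lemma halfDisk_mem_nhds {z : ℂ} (hz : z ∈ halfDisk) (hzi : 0 < z.im) : halfDisk ∈ 𝓝 z := by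
  filter_upwards [(isOpen_lt continuous_norm continuous_const).mem_nhds hz.1,
    (isOpen_lt continuous_const Complex.continuous_im).mem_nhds hzi] with w hw1 hw2
  exact ⟨hw1, le_of_lt hw2⟩

lemma uniqueDiffOn_halfDisk : UniqueDiffOn ℝ halfDisk := by
  refine uniqueDiffOn_convex convex_halfDisk ⟨Complex.I / 2, ?_⟩
  rw [mem_interior_iff_mem_nhds]
  refine halfDisk_mem_nhds ⟨?_, ?_⟩ ?_
  · rw [norm_div, Complex.norm_I, Complex.norm_ofNat]
    norm_num
  all_goals simp

/-- A pseudo-holomorphic half disk in a region of bounded geometry, with `|Df| ≤ M`. -/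
structure IsBoundedHalfDisk {n : ℕ} (J : RSpace n → RSpace n →L[ℝ] RSpace n)
    (L K : Set (RSpace n)) (ρ Λ M : ℝ) (f : ℂ → RSpace n) : Prop where
  almostComplex : IsAlmostComplexStructure J
  one_le : 1 ≤ Λ
  radius_pos : 0 < ρ
  geometry : HasBoundedGeometryOn J L K ρ Λ
  holomorphic : IsPseudoHolomorphic J L f
  mapsTo : MapsTo f halfDisk K
  norm_deriv_le : ∀ z ∈ halfDisk, ‖halfDiskDeriv f z‖ ≤ M

namespace IsBoundedHalfDisk

variable {n : ℕ} {J : RSpace n → RSpace n →L[ℝ] RSpace n} {L K : Set (RSpace n)} {ρ Λ M : ℝ}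
  {f : ℂ → RSpace n}

lemma nonneg (h : IsBoundedHalfDisk J L K ρ Λ M f) : 0 ≤ M :=
  (norm_nonneg _).trans (h.norm_deriv_le 0 ⟨by simp, by simp⟩)

lemma hasFDerivWithinAt (h : IsBoundedHalfDisk J L K ρ Λ M f) {z : ℂ} (hz : z ∈ halfDisk) :
    HasFDerivWithinAt f (halfDiskDeriv f z) halfDisk z :=
  (h.holomorphic.contDiffOn.differentiableOn one_ne_zero z hz).hasFDerivWithinAt

lemma hasFDerivAt (h : IsBoundedHalfDisk J L K ρ Λ M f) {z : ℂ} (hz : z ∈ halfDisk)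
    (hzi : 0 < z.im) : HasFDerivAt f (halfDiskDeriv f z) z :=
  (h.hasFDerivWithinAt hz).hasFDerivAt (halfDisk_mem_nhds hz hzi)

lemma norm_sub_le (h : IsBoundedHalfDisk J L K ρ Λ M f) {z w : ℂ} (hz : z ∈ halfDisk)
    (hw : w ∈ halfDisk) : ‖f z - f w‖ ≤ M * ‖z - w‖ :=
  convex_halfDisk.norm_image_sub_le_of_norm_hasFDerivWithin_le
    (fun _ hx => h.hasFDerivWithinAt hx) h.norm_deriv_le hw hz

/-- The mean value inequality is applied to `J ∘ f` on the convex half disk and not to `J` on `K`: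
the bound on `DJ` holds only on `K`, which need not be convex. -/
lemma norm_J_sub_le (h : IsBoundedHalfDisk J L K ρ Λ M f) {z w : ℂ} (hz : z ∈ halfDisk)
    (hw : w ∈ halfDisk) : ‖J (f z) - J (f w)‖ ≤ Λ * M * ‖z - w‖ := by
  have hΛ : 0 ≤ Λ := zero_le_one.trans h.one_le
  refine convex_halfDisk.norm_image_sub_le_of_norm_hasFDerivWithin_le (f := fun z => J (f z))
    (f' := fun z => (fderiv ℝ J (f z)).comp (halfDiskDeriv f z)) (fun x hx => ?_) (fun x hx => ?_)
    hw hz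
  · exact (h.almostComplex.smooth.differentiable (by simp) (f x)).hasFDerivAt.comp_hasFDerivWithinAt
      x (h.hasFDerivWithinAt hx)
  · refine (ContinuousLinearMap.opNorm_comp_le _ _).trans ?_
    refine mul_le_mul ?_ (h.norm_deriv_le x hx) (norm_nonneg _) hΛ
    refine ContinuousLinearMap.opNorm_le_bound _ hΛ fun u => ?_
    exact ContinuousLinearMap.opNorm_le_bound _ (by positivity) fun v =>
      h.geometry.norm_fderiv_le _ (h.mapsTo hx) u v

lemma deriv_I (h : IsBoundedHalfDisk J L K ρ Λ M f) {z : ℂ} (hz : z ∈ halfDisk) :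
    halfDiskDeriv f z Complex.I = J (f z) (halfDiskDeriv f z 1) := by
  simpa using h.holomorphic.map_I_mul z hz 1

lemma norm_deriv_one_le (h : IsBoundedHalfDisk J L K ρ Λ M f) {z : ℂ} (hz : z ∈ halfDisk) :
    ‖halfDiskDeriv f z 1‖ ≤ M := by
  have := (halfDiskDeriv f z).le_of_opNorm_le (h.norm_deriv_le z hz) 1
  simpa using this

/-- The defect of holomorphy of `f` at `z` for the complex structure frozen at `f w`. -/
lemma norm_dbar_le (h : IsBoundedHalfDisk J L K ρ Λ M f) {z w : ℂ} (hz : z ∈ halfDisk)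
    (hw : w ∈ halfDisk) :
    ‖halfDiskDeriv f z 1 + J (f w) (halfDiskDeriv f z Complex.I)‖ ≤
      Λ ^ 2 * M ^ 2 * ‖z - w‖ := by
  have hΛ : 0 ≤ Λ := zero_le_one.trans h.one_le
  have hM := h.nonneg
  set X := halfDiskDeriv f z 1 with hX
  -- Since `J (f w)` squares to `-1`, `X = -J (f w) (J (f w) X)`.
  have h1 : X + J (f w) (halfDiskDeriv f z Complex.I) = J (f w) ((J (f z) - J (f w)) X) := by
    rw [h.deriv_I hz, sub_apply, map_sub, h.almostComplex.sq_eq_neg]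
    abel
  rw [h1]
  calc ‖J (f w) ((J (f z) - J (f w)) X)‖ ≤ Λ * ‖(J (f z) - J (f w)) X‖ :=
        h.geometry.norm_le _ (h.mapsTo hw) _
    _ ≤ Λ * (Λ * M * ‖z - w‖ * M) := by
        gcongr
        refine (ContinuousLinearMap.le_opNorm _ _).trans ?_
        exact mul_le_mul (h.norm_J_sub_le hz hw) (h.norm_deriv_one_le hz) (norm_nonneg _)
          (by positivity)
    _ = _ := by ring

end IsBoundedHalfDisk

/-! ### Expansions at interior and boundary points -/

/-- Freezing `J` at `f z₀` makes `∂̄f` small. The affine map `b + A(z - z₀)` is subtracted so that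
`B` can be much smaller than the oscillation of `f`, which is what points near the boundary require.
-/
theorem exists_interior_expansion {α : ℝ} (hα0 : 0 < α) (hα1 : α < 1) {Λ : ℝ} (hΛ : 1 ≤ Λ) :
    ∃ C : ℝ, 0 < C ∧ ∀ {n : ℕ} {J : RSpace n → RSpace n →L[ℝ] RSpace n} {L K : Set (RSpace n)}
      {ρ M : ℝ} {f : ℂ → RSpace n}, IsBoundedHalfDisk J L K ρ Λ M f →
      ∀ (z₀ : ℂ) (r B : ℝ) (b : RSpace n) (A : ℂ →L[ℝ] RSpace n), 0 < r → z₀ ∈ halfDisk →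
      (∀ z ∈ Metric.ball z₀ r, z ∈ halfDisk ∧ 0 < z.im) →
      (∀ z ∈ Metric.ball z₀ r, ‖f z - b - A (z - z₀)‖ ≤ B) →
      r * ‖A 1 + J (f z₀) (A Complex.I)‖ ≤ B → M ^ 2 * r ^ 2 ≤ B →
      ∀ z ∈ Metric.ball z₀ (r / 2), ‖f z - f z₀ - halfDiskDeriv f z₀ (z - z₀)‖ ≤
        C * B * (‖z - z₀‖ / r) ^ (1 + α) := by
  obtain ⟨C, hC0, hC⟩ := exists_norm_sub_fderiv_le hα0 hα1 hΛ
  refine ⟨C * Λ ^ 2, by positivity,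
    fun {n J L K ρ M f} h z₀ r B b A hr hz₀ hball happ hA hMr z hz => ?_⟩
  have hB : 0 ≤ B := le_trans (by positivity) hMr
  have hΛ2 : 1 ≤ Λ ^ 2 := one_le_pow₀ hΛ
  have hBΛ : B ≤ Λ ^ 2 * B := le_mul_of_one_le_left hB hΛ2
  -- `A` need not be complex linear for `J (f z₀)`; its antilinear defect is the constant `k`.
  have key := hC (J (f z₀)) (fun z => f z - b - A (z - z₀)) (fun z => halfDiskDeriv f z - A) z₀
    (-(A 1 + J (f z₀) (A Complex.I))) r (Λ ^ 2 * B) hr (by positivity)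
    (h.almostComplex.sq_eq_neg _) (h.geometry.norm_le _ (h.mapsTo hz₀)) ?_
    (fun z hz => (happ z hz).trans hBΛ) (by rw [norm_neg]; exact hA.trans hBΛ) ?_ z hz
  · refine (le_of_eq ?_).trans (key.trans (le_of_eq (by ring)))
    congr 1
    simp only [sub_self, map_zero, sub_zero, sub_apply]
    abel
  · intro z hz
    have h1 := h.hasFDerivAt (hball z hz).1 (hball z hz).2
    exact (h1.sub_const b).sub (A.hasFDerivAt.comp z ((hasFDerivAt_id z).sub_const z₀))
  · intro z hz
    have h1 : (halfDiskDeriv f z - A) 1 + J (f z₀) ((halfDiskDeriv f z - A) Complex.I) -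
        -(A 1 + J (f z₀) (A Complex.I)) =
        halfDiskDeriv f z 1 + J (f z₀) (halfDiskDeriv f z Complex.I) := by
      simp only [sub_apply, map_sub]
      abel
    rw [h1]
    calc r * ‖halfDiskDeriv f z 1 + J (f z₀) (halfDiskDeriv f z Complex.I)‖
        ≤ r * (Λ ^ 2 * M ^ 2 * ‖z - z₀‖) := by
          gcongr
          exact h.norm_dbar_le (hball z hz).1 hz₀
      _ = Λ ^ 2 * (M ^ 2 * r ^ 2) * (‖z - z₀‖ / r) := by field_simp
      _ ≤ Λ ^ 2 * B * (‖z - z₀‖ / r) := by gcongr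

/-- The half disk is straightened by the chart at `f z₀`. The condition `Ms < ρ` keeps its image in
the domain of the chart, and `Ms ≤ 1` absorbs the quadratic errors `(Ms)²` into `Ms`. -/
theorem exists_boundary_expansion {α : ℝ} (hα0 : 0 < α) (hα1 : α < 1) {Λ : ℝ} (hΛ : 1 ≤ Λ) :
    ∃ C : ℝ, 0 < C ∧ ∀ {n : ℕ} {J : RSpace n → RSpace n →L[ℝ] RSpace n} {L K : Set (RSpace n)}
      {ρ M : ℝ} {f : ℂ → RSpace n}, IsBoundedHalfDisk J L K ρ Λ M f →
      ∀ (z₀ : ℂ) (s : ℝ), 0 < s → z₀.im = 0 → ‖z₀‖ + s ≤ 1 → M * s < ρ → M * s ≤ 1 →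
      ∀ z ∈ Metric.ball z₀ (s / 2), 0 ≤ z.im → ‖f z - f z₀ - halfDiskDeriv f z₀ (z - z₀)‖ ≤
        C * (M * s) * (‖z - z₀‖ / s) ^ (1 + α) := by
  -- One constant has to bound both `J` and the projection `P`.
  have hΛ' : 1 ≤ 1 + Λ ^ 2 := by nlinarith
  obtain ⟨C, hC0, hC⟩ := exists_norm_sub_fderivWithin_le hα0 hα1 hΛ'
  refine ⟨C * (3 * Λ ^ 4) + Λ ^ 2, by positivity,
    fun {n J L K ρ M f} h z₀ s hs hz₀i hz₀s hMρ hM1 => ?_⟩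
  have hM := h.nonneg
  have hMs : 0 ≤ M * s := by positivity
  have hΛ2 : 1 ≤ Λ ^ 2 := one_le_pow₀ hΛ
  have hΛ4 : Λ ^ 2 ≤ Λ ^ 4 := pow_le_pow_right₀ hΛ (by norm_num)
  have hmem : ∀ z ∈ Metric.ball z₀ s, 0 ≤ z.im → z ∈ halfDisk := fun z hz hzi => by
    refine ⟨?_, hzi⟩
    have h1 : ‖z - z₀‖ < s := by simpa [dist_eq_norm] using hz
    have h2 := norm_le_norm_add_norm_sub' z z₀
    linarith
  have hz₀ : z₀ ∈ halfDisk := hmem z₀ (Metric.mem_ball_self hs) hz₀i.ge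
  obtain ⟨ψ, ψ', W, P, hψp, hψd, hψb, hψL, hP1, hP2, hP3⟩ :=
    h.geometry.exists_straightening h.radius_pos hΛ h.almostComplex
      ⟨h.holomorphic.map_boundary z₀ hz₀ hz₀i, h.mapsTo hz₀⟩
  have hdist : ∀ z ∈ Metric.ball z₀ s, 0 ≤ z.im →
      ‖f z - f z₀‖ ≤ M * ‖z - z₀‖ ∧ M * ‖z - z₀‖ ≤ M * s := fun z hz hzi => by
    have h1 : ‖z - z₀‖ < s := by simpa [dist_eq_norm] using hz
    exact ⟨h.norm_sub_le (hmem z hz hzi) hz₀, mul_le_mul_of_nonneg_left h1.le hM⟩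
  have hfball : ∀ z ∈ Metric.ball z₀ s, 0 ≤ z.im → f z ∈ Metric.ball (f z₀) ρ :=
    fun z hz hzi => by
      rw [Metric.mem_ball, dist_eq_norm]
      exact ((hdist z hz hzi).1.trans (hdist z hz hzi).2).trans_lt hMρ
  -- Mean value inequality for `ψ - id` on the closed ball of radius `‖w - f z₀‖`.
  have hψ2 : ∀ w ∈ Metric.ball (f z₀) ρ, ‖ψ w - (w - f z₀)‖ ≤ Λ ^ 2 * ‖w - f z₀‖ ^ 2 := by
    intro w hw
    have hw' : ‖w - f z₀‖ < ρ := by simpa [dist_eq_norm] using hw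
    have hsub : Metric.closedBall (f z₀) ‖w - f z₀‖ ⊆ Metric.ball (f z₀) ρ :=
      Metric.closedBall_subset_ball hw'
    have := (convex_closedBall (f z₀) ‖w - f z₀‖).norm_image_sub_le_of_norm_hasFDerivWithin_le'
      (f := ψ) (f' := ψ') (φ := ContinuousLinearMap.id ℝ (RSpace n)) (C := Λ ^ 2 * ‖w - f z₀‖)
      (fun x hx => (hψd x (hsub hx)).hasFDerivWithinAt) (fun x hx => ?_)
      (Metric.mem_closedBall_self (norm_nonneg _)) (y := w) (by simp [dist_eq_norm])
    · rw [hψp, sub_zero, ContinuousLinearMap.id_apply] at this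
      exact this.trans (le_of_eq (by ring))
    · refine ContinuousLinearMap.opNorm_le_bound _ (by positivity) fun v => ?_
      refine (hψb x (hsub hx) v).trans ?_
      have hx' : ‖x - f z₀‖ ≤ ‖w - f z₀‖ := by simpa [dist_eq_norm] using hx
      gcongr
  have hψ'p : ψ' (f z₀) = ContinuousLinearMap.id ℝ (RSpace n) := by
    ext1 v
    have := hψb (f z₀) (Metric.mem_ball_self h.radius_pos) v
    rw [sub_self, norm_zero, mul_zero, zero_mul] at this
    exact sub_eq_zero.1 (norm_le_zero_iff.1 this)
  have hJΛ : ∀ w ∈ halfDisk, ∀ v, ‖J (f w) v‖ ≤ Λ * ‖v‖ := fun w hw =>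
    h.geometry.norm_le _ (h.mapsTo hw)
  -- The factor `3Λ⁴` dominates both `1 + Λ²`, from the size of `ψ ∘ f`, and `2Λ² + Λ⁴`, from its
  -- `∂̄`.
  have key := hC (J (f z₀)) P W (fun z => ψ (f z))
    (fun z => (ψ' (f z)).comp (halfDiskDeriv f z)) halfDisk z₀ s (3 * Λ ^ 4 * (M * s)) hs
    (by positivity) hz₀i (h.almostComplex.sq_eq_neg _)
    (fun v => (hJΛ z₀ hz₀ v).trans (by gcongr; nlinarith)) hP1 hP2 hP3 (fun z hz => hz.2)
    (uniqueDiffOn_halfDisk z₀ hz₀)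
    ((hψd _ (Metric.mem_ball_self h.radius_pos)).comp_hasFDerivWithinAt z₀ (h.hasFDerivWithinAt hz₀))
    (fun z hz => ((hψd _ (hfball z hz.1 hz.2)).continuousAt.comp_continuousWithinAt
      ((h.holomorphic.contDiffOn.continuousOn z (hmem z hz.1 hz.2)).mono
        fun w hw => hmem w hw.1 hw.2)))
    (fun z hz hzi => (hψd _ (hfball z hz hzi.le)).comp z
      (h.hasFDerivAt (hmem z hz hzi.le) hzi))
    (fun z hz hzi => ?_)
    (fun z hz hzi => hψL _ (hfball z hz hzi.ge)
      (h.holomorphic.map_boundary z (hmem z hz hzi.ge) hzi))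
    (fun z hz hzi => ?_)
  · intro z hz hzi
    have hzs : z ∈ Metric.ball z₀ s := Metric.ball_subset_ball (by linarith) hz
    have h1 := key z hz hzi
    simp only [hψp, hψ'p, ContinuousLinearMap.id_comp, sub_zero] at h1
    have h2 := hψ2 _ (hfball z hzs hzi)
    have h3 : ‖f z - f z₀‖ ^ 2 ≤ M * s * (‖z - z₀‖ / s) ^ (1 + α) := by
      have hts : ‖z - z₀‖ / s ≤ 1 := by
        have : ‖z - z₀‖ < s := by simpa [dist_eq_norm] using hzs
        rw [div_le_one hs]
        exact this.le
      calc ‖f z - f z₀‖ ^ 2 ≤ (M * ‖z - z₀‖) ^ 2 := by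
            gcongr
            exact (hdist z hzs hzi).1
        _ = M * s * (M * s) * (‖z - z₀‖ / s) ^ 2 := by field_simp
        _ ≤ M * s * 1 * (‖z - z₀‖ / s) ^ (1 + α) := by
            gcongr
            rw [← Real.rpow_natCast]
            refine Real.rpow_le_rpow_of_exponent_ge_of_imp (by positivity) hts ?_ ?_
            · push_cast
              linarith
            · intro _ h0
              exact absurd h0 (by positivity)
        _ = _ := by ring
    -- Returning from `ψ ∘ f` to `f` costs a term quadratic in `‖f z - f z₀‖`, which is within the
    -- allowed order as `1 + α < 2`.
    have h4 : f z - f z₀ - halfDiskDeriv f z₀ (z - z₀) =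
        (ψ (f z) - halfDiskDeriv f z₀ (z - z₀)) - (ψ (f z) - (f z - f z₀)) := by abel
    rw [h4]
    calc _ ≤ ‖ψ (f z) - halfDiskDeriv f z₀ (z - z₀)‖ + ‖ψ (f z) - (f z - f z₀)‖ :=
          _root_.norm_sub_le _ _
      _ ≤ C * (3 * Λ ^ 4 * (M * s)) * (‖z - z₀‖ / s) ^ (1 + α) +
          Λ ^ 2 * (M * s * (‖z - z₀‖ / s) ^ (1 + α)) := by
          refine add_le_add h1 (h2.trans ?_)
          gcongr
      _ = _ := by ring
  · have h1 := (hdist z hz hzi).1.trans (hdist z hz hzi).2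
    have h2 := hψ2 _ (hfball z hz hzi)
    have h3 : ‖ψ (f z)‖ ≤ ‖f z - f z₀‖ + ‖ψ (f z) - (f z - f z₀)‖ :=
      norm_le_norm_add_norm_sub' _ _
    have h4 : ‖f z - f z₀‖ ^ 2 ≤ M * s := by
      have := norm_nonneg (f z - f z₀)
      nlinarith
    calc ‖ψ (f z)‖ ≤ M * s + Λ ^ 2 * (M * s) := by
          refine h3.trans (add_le_add h1 (h2.trans ?_))
          gcongr
      _ = (1 + Λ ^ 2) * (M * s) := by ring
      _ ≤ 3 * Λ ^ 4 * (M * s) := by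
          gcongr
          linarith
  · have hzH := hmem z hz hzi.le
    have hzb := hfball z hz hzi.le
    set X := halfDiskDeriv f z 1 with hX
    have hXM : ‖X‖ ≤ M := h.norm_deriv_one_le hzH
    set t := ‖z - z₀‖ with ht
    have hft : ‖f z - f z₀‖ ≤ M * t := (hdist z hz hzi.le).1
    have e1 : ‖X + J (f z₀) (J (f z) X)‖ ≤ Λ ^ 2 * M ^ 2 * t := by
      have := h.norm_dbar_le hzH hz₀
      rwa [h.deriv_I hzH] at this
    have e2 : ‖ψ' (f z) X - X‖ ≤ Λ ^ 2 * (M * t) * M := by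
      refine (hψb _ hzb X).trans ?_
      gcongr
    have e3 : ‖J (f z₀) (ψ' (f z) (J (f z) X) - J (f z) X)‖ ≤
        Λ * (Λ ^ 2 * (M * t) * (Λ * M)) := by
      refine (hJΛ z₀ hz₀ _).trans ?_
      gcongr
      refine (hψb _ hzb _).trans ?_
      gcongr
      refine (hJΛ z hzH X).trans ?_
      gcongr
    have hdec : ((ψ' (f z)).comp (halfDiskDeriv f z)) 1 +
        J (f z₀) (((ψ' (f z)).comp (halfDiskDeriv f z)) Complex.I) =
        -- The three terms are the defect of frozen holomorphy and the deviations of `ψ'` from the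
        -- identity on `X` and on `J (f z) X`.
        (X + J (f z₀) (J (f z) X)) + (ψ' (f z) X - X) +
          J (f z₀) (ψ' (f z) (J (f z) X) - J (f z) X) := by
      rw [ContinuousLinearMap.comp_apply, ContinuousLinearMap.comp_apply, h.deriv_I hzH, map_sub]
      abel
    rw [hdec]
    calc _ ≤ s * (Λ ^ 2 * M ^ 2 * t + Λ ^ 2 * (M * t) * M + Λ * (Λ ^ 2 * (M * t) * (Λ * M))) := by
          gcongr
          exact (norm_add_le _ _).trans (add_le_add ((norm_add_le _ _).trans (add_le_add e1 e2)) e3)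
      _ = (2 * Λ ^ 2 + Λ ^ 4) * ((M * s) * (M * s)) * (t / s) := by
          field_simp
          ring
      _ ≤ (3 * Λ ^ 4) * ((M * s) * 1) * (t / s) := by
          gcongr
          linarith
      _ = _ := by ring

/-! ### From uniform expansions to the Hölder bound -/

/-- The increments from `y` to `y + τ v` of the two affine maps agree up to the errors at the two
endpoints, whatever the constant terms are. -/
lemma norm_sub_le_of_affine_approx {F : Type*} [NormedAddCommGroup F] [NormedSpace ℝ F]
    {f : ℂ → F} {b₀ b₁ : F} {A₀ A₁ : ℂ →L[ℝ] F} {z₀ z₁ y : ℂ} {τ ε₀ ε₁ : ℝ} (hτ : 0 < τ)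
    (h₀ : ∀ x ∈ Metric.closedBall y τ, ‖f x - b₀ - A₀ (x - z₀)‖ ≤ ε₀)
    (h₁ : ∀ x ∈ Metric.closedBall y τ, ‖f x - b₁ - A₁ (x - z₁)‖ ≤ ε₁) :
    ‖A₀ - A₁‖ ≤ 2 * (ε₀ + ε₁) / τ := by
  have hy : y ∈ Metric.closedBall y τ := Metric.mem_closedBall_self hτ.le
  have hε : 0 ≤ ε₀ + ε₁ :=
    add_nonneg ((norm_nonneg _).trans (h₀ y hy)) ((norm_nonneg _).trans (h₁ y hy))
  refine ContinuousLinearMap.opNorm_le_of_unit_norm (by positivity) fun v hv => ?_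
  have hyv : y + τ • v ∈ Metric.closedBall y τ := by
    rw [Metric.mem_closedBall, dist_eq_norm, add_sub_cancel_left, norm_smul, hv,
      Real.norm_of_nonneg hτ.le, mul_one]
  have h1 : τ • (A₀ - A₁) v = (f y - b₀ - A₀ (y - z₀)) - (f (y + τ • v) - b₀ - A₀ (y + τ • v - z₀))
      - ((f y - b₁ - A₁ (y - z₁)) - (f (y + τ • v) - b₁ - A₁ (y + τ • v - z₁))) := by
    simp only [sub_apply, map_sub, map_add, map_smul, smul_sub]
    abel
  have h2 : τ * ‖(A₀ - A₁) v‖ ≤ 2 * (ε₀ + ε₁) := by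
    calc τ * ‖(A₀ - A₁) v‖ = ‖τ • (A₀ - A₁) v‖ := by
          rw [norm_smul, Real.norm_of_nonneg hτ.le]
      _ ≤ (ε₀ + ε₀) + (ε₁ + ε₁) := by
          rw [h1]
          refine (norm_sub_le _ _).trans (add_le_add ((norm_sub_le _ _).trans ?_)
            ((norm_sub_le _ _).trans ?_))
          · exact add_le_add (h₀ _ hy) (h₀ _ hyv)
          · exact add_le_add (h₁ _ hy) (h₁ _ hyv)
      _ = _ := by ring
  rw [le_div_iff₀ hτ]
  linarith

lemma mul_rpow_one_add_le {α : ℝ} (hα0 : 0 < α) (hα1 : α < 1) {c x : ℝ} (hc : 1 ≤ c)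
    (hx : 0 ≤ x) : (c * x) ^ (1 + α) ≤ c ^ 2 * x ^ (1 + α) := by
  rw [Real.mul_rpow (by linarith) hx]
  gcongr
  rw [← Real.rpow_natCast]
  refine Real.rpow_le_rpow_of_exponent_le hc ?_
  push_cast
  linarith

lemma norm_sub_ofReal_re {z : ℂ} (hz : 0 ≤ z.im) : ‖z - (z.re : ℂ)‖ = z.im := by
  have : z - (z.re : ℂ) = z.im * Complex.I := by
    apply Complex.ext <;> simp
  rw [this, norm_mul, Complex.norm_I, mul_one, Complex.norm_real, Real.norm_of_nonneg hz]

/-- First order expansion, with a remainder of order `1 + α`, at all points of a half disk. -/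
theorem exists_expansion {α : ℝ} (hα0 : 0 < α) (hα1 : α < 1) {Λ : ℝ} (hΛ : 1 ≤ Λ) :
    ∃ C : ℝ, 0 < C ∧ ∀ {n : ℕ} {J : RSpace n → RSpace n →L[ℝ] RSpace n} {L K : Set (RSpace n)}
      {ρ M : ℝ} {f : ℂ → RSpace n}, IsBoundedHalfDisk J L K ρ Λ M f →
      ∀ (z₀ : ℂ) (s : ℝ), 0 < s → 0 ≤ z₀.im → ‖z₀‖ + s ≤ 1 → M * s < ρ → M * s ≤ 1 →
      ∀ z ∈ Metric.ball z₀ (s / 16), 0 ≤ z.im → ‖f z - f z₀ - halfDiskDeriv f z₀ (z - z₀)‖ ≤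
        C * (M * s) * (‖z - z₀‖ / s) ^ (1 + α) := by
  obtain ⟨C₁, hC₁, hbdry⟩ := exists_boundary_expansion hα0 hα1 hΛ
  obtain ⟨C₂, hC₂, hint⟩ := exists_interior_expansion hα0 hα1 hΛ
  -- `4 C₁` bounds the boundary expansion on the disk about `z₀` of radius `d = Im z₀`, whose points
  -- are within `2d` of the nearest boundary point; `Λ²` pays for the `∂̄` defects.
  set D : ℝ := 4 * C₁ + Λ ^ 2 with hD
  have hD0 : 0 < D := by positivity
  refine ⟨C₁ + 64 * C₂ + C₂ * D + (9 * C₁ + 4 * D + 16 * (C₂ + 1) * D), by positivity,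
    fun {n J L K ρ M f} h z₀ s hs hz₀i hz₀s hMρ hM1 z hz hzi => ?_⟩
  have hM := h.nonneg
  have hMs : 0 ≤ M * s := by positivity
  have hz' : ‖z - z₀‖ < s / 16 := by simpa [dist_eq_norm] using hz
  have hmem : ∀ w, ‖w - z₀‖ < s → 0 ≤ w.im → w ∈ halfDisk := fun w hw hwi => by
    refine ⟨?_, hwi⟩
    have h2 := norm_le_norm_add_norm_sub' w z₀
    linarith
  have hz₀ : z₀ ∈ halfDisk := hmem z₀ (by simpa using hs) hz₀i
  set R : ℝ := M * s * (‖z - z₀‖ / s) ^ (1 + α) with hR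
  have hR0 : 0 ≤ R := by positivity
  have him : ∀ w, |w.im - z₀.im| ≤ ‖w - z₀‖ := fun w => by
    simpa using Complex.abs_im_le_norm (w - z₀)
  suffices ‖f z - f z₀ - halfDiskDeriv f z₀ (z - z₀)‖ ≤ C₁ * R ∨
      ‖f z - f z₀ - halfDiskDeriv f z₀ (z - z₀)‖ ≤ 64 * C₂ * R ∨
      ‖f z - f z₀ - halfDiskDeriv f z₀ (z - z₀)‖ ≤ C₂ * D * R ∨
      ‖f z - f z₀ - halfDiskDeriv f z₀ (z - z₀)‖ ≤ (9 * C₁ + 4 * D + 16 * (C₂ + 1) * D) * R by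
    have e1 : 0 ≤ C₁ * R := by positivity
    have e2 : 0 ≤ 64 * C₂ * R := by positivity
    have e3 : 0 ≤ C₂ * D * R := by positivity
    have e4 : 0 ≤ (9 * C₁ + 4 * D + 16 * (C₂ + 1) * D) * R := by positivity
    rw [mul_assoc, ← hR]
    rcases this with h | h | h | h <;> linarith
  rcases hz₀i.eq_or_lt with hd0 | hd0
  · -- boundary points
    left
    have := hbdry h z₀ s hs hd0.symm hz₀s hMρ hM1 z
      (Metric.ball_subset_ball (by linarith) hz) hzi
    exact this.trans (le_of_eq (by ring))
  rcases le_or_gt (s / 8) z₀.im with hds | hds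
  · -- points far from the boundary
    right; left
    have hb : ∀ w ∈ Metric.ball z₀ (s / 8), w ∈ halfDisk ∧ 0 < w.im := fun w hw => by
      have hw' : ‖w - z₀‖ < s / 8 := by simpa [dist_eq_norm] using hw
      have := (abs_le.1 (him w)).1
      have hwi : 0 < w.im := by linarith
      exact ⟨hmem w (by linarith) hwi.le, hwi⟩
    have key := hint h z₀ (s / 8) (M * s) (f z₀) 0 (by positivity) hz₀ hb (fun w hw => by
        rw [zero_apply, sub_zero]
        have hw' : ‖w - z₀‖ < s / 8 := by simpa [dist_eq_norm] using hw
        refine (h.norm_sub_le (hb w hw).1 hz₀).trans ?_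
        gcongr
        linarith) (by simpa using hMs) (by nlinarith) z
        (Metric.ball_subset_ball (by linarith) hz)
    refine key.trans ?_
    have h1 : ‖z - z₀‖ / (s / 8) = 8 * (‖z - z₀‖ / s) := by field_simp
    rw [h1]
    have h2 := mul_rpow_one_add_le hα0 hα1 (c := 8) (by norm_num)
      (x := ‖z - z₀‖ / s) (by positivity)
    calc C₂ * (M * s) * (8 * (‖z - z₀‖ / s)) ^ (1 + α)
        ≤ C₂ * (M * s) * (8 ^ 2 * (‖z - z₀‖ / s) ^ (1 + α)) := by gcongr
      _ = _ := by rw [hR]; ring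
  -- points near the boundary
  set d := z₀.im with hdd
  set z₁ : ℂ := (z₀.re : ℂ) with hz₁
  have hz₀₁ : ‖z₀ - z₁‖ = d := norm_sub_ofReal_re hz₀i
  have hz₁n : ‖z₁‖ ≤ ‖z₀‖ := by
    rw [hz₁, Complex.norm_real]
    exact Complex.abs_re_le_norm z₀
  have hz₁H : z₁ ∈ halfDisk := hmem z₁ (by rw [norm_sub_rev, hz₀₁]; linarith) (by simp [hz₁])
  have hB₁ : ∀ w, ‖w - z₁‖ < s / 2 → 0 ≤ w.im →
      ‖f w - f z₁ - halfDiskDeriv f z₁ (w - z₁)‖ ≤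
        C₁ * (M * s) * (‖w - z₁‖ / s) ^ (1 + α) := fun w hw hwi =>
    hbdry h z₁ s hs (by simp [hz₁]) (by linarith) hMρ hM1 w (by simpa [dist_eq_norm] using hw) hwi
  set B : ℝ := D * (M * s) * (d / s) ^ (1 + α) with hB
  have hB0 : 0 ≤ B := by positivity
  have hMd : M ^ 2 * d ^ 2 ≤ M * s * (d / s) ^ (1 + α) := by
    have hds1 : d / s ≤ 1 := by
      rw [div_le_one hs]
      linarith
    calc M ^ 2 * d ^ 2 = M * s * (M * s) * (d / s) ^ 2 := by field_simp
      _ ≤ M * s * 1 * (d / s) ^ (1 + α) := by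
          gcongr
          rw [← Real.rpow_natCast]
          refine Real.rpow_le_rpow_of_exponent_ge (by positivity) hds1 ?_
          push_cast
          linarith
      _ = _ := by ring
  have hMd0 : 0 ≤ M * s * (d / s) ^ (1 + α) := by positivity
  have hMdB : Λ ^ 2 * (M ^ 2 * d ^ 2) ≤ B := by
    calc Λ ^ 2 * (M ^ 2 * d ^ 2) ≤ D * (M * s * (d / s) ^ (1 + α)) := by
          refine mul_le_mul ?_ hMd (by positivity) hD0.le
          rw [hD]
          linarith
      _ = B := by rw [hB]; ring
  have hballd : ∀ w ∈ Metric.ball z₀ d, w ∈ halfDisk ∧ 0 < w.im := fun w hw => by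
    have hw' : ‖w - z₀‖ < d := by simpa [dist_eq_norm] using hw
    have := (abs_le.1 (him w)).1
    have hwi : 0 < w.im := by linarith
    exact ⟨hmem w (by linarith) hwi.le, hwi⟩
  have htri : ∀ w, ‖w - z₁‖ ≤ ‖w - z₀‖ + d := fun w => by
    have := norm_sub_le_norm_sub_add_norm_sub w z₀ z₁
    rwa [hz₀₁] at this
  -- the affine approximation at the boundary point
  have happ : ∀ w ∈ Metric.ball z₀ d, ‖f w - f z₁ - halfDiskDeriv f z₁ (w - z₁)‖ ≤ B := by
    intro w hw
    have hw' : ‖w - z₀‖ < d := by simpa [dist_eq_norm] using hw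
    have h1 := htri w
    have h3 : (‖w - z₁‖ / s) ^ (1 + α) ≤ 2 ^ 2 * (d / s) ^ (1 + α) := by
      refine le_trans ?_ (mul_rpow_one_add_le hα0 hα1 (c := 2) (by norm_num)
        (x := d / s) (by positivity))
      refine Real.rpow_le_rpow (by positivity) ?_ (by linarith)
      rw [← mul_div_assoc]
      gcongr
      linarith
    calc _ ≤ C₁ * (M * s) * (‖w - z₁‖ / s) ^ (1 + α) :=
          hB₁ w (by linarith) (hballd w hw).2.le
      _ ≤ C₁ * (M * s) * (2 ^ 2 * (d / s) ^ (1 + α)) := by gcongr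
      _ = 4 * C₁ * (M * s * (d / s) ^ (1 + α)) := by ring
      _ ≤ D * (M * s * (d / s) ^ (1 + α)) := by
          gcongr
          rw [hD]
          have : 0 ≤ Λ ^ 2 := by positivity
          linarith
      _ = B := by rw [hB]; ring
  have hΛ2 : 1 ≤ Λ ^ 2 := one_le_pow₀ hΛ
  have key : ∀ w ∈ Metric.ball z₀ (d / 2), ‖f w - f z₀ - halfDiskDeriv f z₀ (w - z₀)‖ ≤
      C₂ * B * (‖w - z₀‖ / d) ^ (1 + α) := by
    -- The subtracted affine map is the first order expansion at the nearest boundary point,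
    -- rewritten with base point `z₀`.
    refine hint h z₀ d B (f z₁ + halfDiskDeriv f z₁ (z₀ - z₁)) (halfDiskDeriv f z₁) hd0 hz₀ hballd
      (fun w hw => ?_) ?_ ?_
    · refine (le_of_eq ?_).trans (happ w hw)
      congr 1
      simp only [map_sub]
      abel
    · refine le_trans ?_ hMdB
      calc d * _ ≤ d * (Λ ^ 2 * M ^ 2 * ‖z₁ - z₀‖) := by
            gcongr
            exact h.norm_dbar_le hz₁H hz₀
        _ = _ := by
            rw [norm_sub_rev, hz₀₁]
            ring
    · exact (le_mul_of_one_le_left (by positivity) hΛ2).trans hMdB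
  rcases lt_or_ge ‖z - z₀‖ (d / 2) with hzd | hzd
  · right; right; left
    refine (key z (by simpa [dist_eq_norm] using hzd)).trans (le_of_eq ?_)
    have h1 : (‖z - z₀‖ / s) ^ (1 + α) =
        (d / s) ^ (1 + α) * (‖z - z₀‖ / d) ^ (1 + α) := by
      rw [← Real.mul_rpow (by positivity) (by positivity)]
      congr 1
      field_simp
    rw [hR, hB, h1]
    ring
  -- Here `|z - z₀|` is at least `d/2`, so the expansion at the boundary point `z₁` can be used at
  -- `z`; it remains to exchange `Df(z₁)` for `Df(z₀)`.
  · right; right; right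
    set t := ‖z - z₀‖ with ht
    have ht0 : 0 < t := by linarith
    -- the two differentials are close
    have hA : ‖halfDiskDeriv f z₀ - halfDiskDeriv f z₁‖ ≤ 2 * (C₂ * B + B) / (d / 4) := by
      refine norm_sub_le_of_affine_approx (f := f) (b₀ := f z₀) (b₁ := f z₁) (z₀ := z₀) (z₁ := z₁)
        (y := z₀) (by positivity) (fun w hw => ?_) fun w hw => ?_
      · have hw' : ‖w - z₀‖ ≤ d / 4 := by simpa [dist_eq_norm] using hw
        refine (key w (by rw [Metric.mem_ball, dist_eq_norm]; linarith)).trans ?_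
        refine mul_le_of_le_one_right (by positivity) (Real.rpow_le_one (by positivity) ?_
          (by linarith))
        rw [div_le_one hd0]
        linarith
      · have hw' : ‖w - z₀‖ ≤ d / 4 := by simpa [dist_eq_norm] using hw
        exact happ w (by rw [Metric.mem_ball, dist_eq_norm]; linarith)
    have hzz₁ : ‖z - z₁‖ ≤ 3 * t := (htri z).trans (by linarith)
    have e1 : ‖f z - f z₁ - halfDiskDeriv f z₁ (z - z₁)‖ ≤ 9 * C₁ * R := by
      have h3 : (‖z - z₁‖ / s) ^ (1 + α) ≤ 3 ^ 2 * (t / s) ^ (1 + α) := by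
        refine le_trans ?_ (mul_rpow_one_add_le hα0 hα1 (c := 3) (by norm_num)
          (x := t / s) (by positivity))
        refine Real.rpow_le_rpow (by positivity) ?_ (by linarith)
        rw [← mul_div_assoc]
        gcongr
      calc _ ≤ C₁ * (M * s) * (‖z - z₁‖ / s) ^ (1 + α) := hB₁ z (by linarith) hzi
        _ ≤ C₁ * (M * s) * (3 ^ 2 * (t / s) ^ (1 + α)) := by gcongr
        _ = _ := by rw [hR]; ring
    have hdt : (d / s) ^ (1 + α) ≤ 4 * (t / s) ^ (1 + α) := by
      have := mul_rpow_one_add_le hα0 hα1 (c := 2) (by norm_num) (x := t / s) (by positivity)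
      norm_num at this
      refine le_trans (Real.rpow_le_rpow (by positivity) ?_ (by linarith)) this
      rw [← mul_div_assoc]
      gcongr
      linarith
    have e2 : ‖f z₀ - f z₁ - halfDiskDeriv f z₁ (z₀ - z₁)‖ ≤ 4 * D * R := by
      refine (happ z₀ (Metric.mem_ball_self hd0)).trans ?_
      calc B ≤ D * (M * s) * (4 * (t / s) ^ (1 + α)) := by rw [hB]; gcongr
        _ = _ := by rw [hR]; ring
    have hBt : B / d * t ≤ 2 * D * R := by
      have h1 : (d / s) ^ (1 + α) / d * t = (d / s) ^ α * (t / s) := by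
        rw [Real.rpow_add (by positivity), Real.rpow_one]
        field_simp
      have h2 : (d / s) ^ α ≤ 2 * (t / s) ^ α := by
        calc (d / s) ^ α ≤ (2 * (t / s)) ^ α := by
              refine Real.rpow_le_rpow (by positivity) ?_ hα0.le
              rw [← mul_div_assoc]
              gcongr
              linarith
          _ = 2 ^ α * (t / s) ^ α := Real.mul_rpow (by norm_num) (by positivity)
          _ ≤ 2 * (t / s) ^ α := by
              gcongr
              exact (Real.rpow_le_rpow_of_exponent_le (by norm_num) hα1.le).trans_eq
                (Real.rpow_one 2)
      have h3 : (t / s) ^ (1 + α) = (t / s) * (t / s) ^ α := by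
        rw [Real.rpow_add (by positivity), Real.rpow_one]
      calc B / d * t = D * (M * s) * ((d / s) ^ (1 + α) / d * t) := by rw [hB]; ring
        _ = D * (M * s) * ((d / s) ^ α * (t / s)) := by rw [h1]
        _ ≤ D * (M * s) * (2 * (t / s) ^ α * (t / s)) := by gcongr
        _ = _ := by rw [hR, h3]; ring
    have e3 : ‖(halfDiskDeriv f z₀ - halfDiskDeriv f z₁) (z - z₀)‖ ≤ 16 * (C₂ + 1) * D * R := by
      calc _ ≤ 2 * (C₂ * B + B) / (d / 4) * t := ContinuousLinearMap.le_of_opNorm_le _ hA _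
        _ = 8 * (C₂ + 1) * (B / d * t) := by
            field_simp
            ring
        _ ≤ 8 * (C₂ + 1) * (2 * D * R) := by gcongr
        _ = _ := by ring
    have hdec : f z - f z₀ - halfDiskDeriv f z₀ (z - z₀) =
        (f z - f z₁ - halfDiskDeriv f z₁ (z - z₁)) -
        (f z₀ - f z₁ - halfDiskDeriv f z₁ (z₀ - z₁)) -
        (halfDiskDeriv f z₀ - halfDiskDeriv f z₁) (z - z₀) := by
      simp only [sub_apply, map_sub]
      abel
    rw [hdec]
    calc _ ≤ 9 * C₁ * R + 4 * D * R + 16 * (C₂ + 1) * D * R :=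
          (norm_sub_le _ _).trans (add_le_add ((norm_sub_le _ _).trans (add_le_add e1 e2)) e3)
      _ = _ := by ring

/-- Close points are compared through their two expansions on a common disk. For points at distance
at least `s/64`, the trivial bound `2M` is already of the required size. -/
theorem exists_holder_bound {α : ℝ} (hα0 : 0 < α) (hα1 : α < 1) {Λ : ℝ} (hΛ : 1 ≤ Λ) :
    ∃ C : ℝ, 0 < C ∧ ∀ {n : ℕ} {J : RSpace n → RSpace n →L[ℝ] RSpace n} {L K : Set (RSpace n)}
      {ρ M : ℝ} {f : ℂ → RSpace n}, IsBoundedHalfDisk J L K ρ Λ M f →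
      ∀ (z₁ z₂ : ℂ) (s : ℝ), 0 < s → 0 ≤ z₁.im → 0 ≤ z₂.im → ‖z₁‖ + s ≤ 1 → ‖z₂‖ + s ≤ 1 →
      M * s < ρ → M * s ≤ 1 →
      ‖halfDiskDeriv f z₁ - halfDiskDeriv f z₂‖ ≤ C * M * (‖z₁ - z₂‖ / s) ^ α := by
  obtain ⟨C, hC0, hC⟩ := exists_expansion hα0 hα1 hΛ
  refine ⟨64 * C + 128, by positivity,
    fun {n J L K ρ M f} h z₁ z₂ s hs hz₁i hz₂i hz₁s hz₂s hMρ hM1 => ?_⟩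
  have hM := h.nonneg
  rcases eq_or_ne z₁ z₂ with rfl | hne
  · rw [sub_self, norm_zero]
    positivity
  set t := ‖z₁ - z₂‖ with ht
  have ht0 : 0 < t := norm_pos_iff.2 (sub_ne_zero.2 hne)
  have hX : 0 ≤ M * (t / s) ^ α := by positivity
  rcases lt_or_ge t (s / 64) with hts | hts
  · have hsplit : (t / s) ^ (1 + α) = (t / s) * (t / s) ^ α := by
      rw [Real.rpow_add (by positivity), Real.rpow_one]
    -- Moving up by `2t` puts the closed disk of radius `t` about `y` inside the upper half plane,
    -- within `4t < s/16` of both points.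
    set y : ℂ := z₁ + (2 * t : ℝ) * Complex.I with hy
    have hyz : ‖y - z₁‖ = 2 * t := by
      rw [hy, add_sub_cancel_left, norm_mul, Complex.norm_I, mul_one, Complex.norm_real,
        Real.norm_of_nonneg (by positivity)]
    have hyi : y.im = z₁.im + 2 * t := by simp [hy]
    have hpt : ∀ x ∈ Metric.closedBall y t, 0 ≤ x.im ∧ ‖x - z₁‖ ≤ 4 * t ∧ ‖x - z₂‖ ≤ 4 * t := by
      intro x hx
      have hx' : ‖x - y‖ ≤ t := by simpa [dist_eq_norm] using hx
      have h1 := (abs_le.1 ((Complex.abs_im_le_norm (x - y)).trans hx')).1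
      rw [Complex.sub_im, hyi] at h1
      have h2 := norm_sub_le_norm_sub_add_norm_sub x y z₁
      have h3 := norm_sub_le_norm_sub_add_norm_sub x z₁ z₂
      exact ⟨by linarith, by linarith, by linarith⟩
    have hε : ∀ w x : ℂ, 0 ≤ w.im → ‖w‖ + s ≤ 1 → 0 ≤ x.im → ‖x - w‖ ≤ 4 * t →
        ‖f x - f w - halfDiskDeriv f w (x - w)‖ ≤ 16 * C * (M * s) * (t / s) ^ (1 + α) := by
      intro w x hwi hws hxi hxw
      have h3 : (‖x - w‖ / s) ^ (1 + α) ≤ 4 ^ 2 * (t / s) ^ (1 + α) := by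
        refine le_trans ?_ (mul_rpow_one_add_le hα0 hα1 (c := 4) (by norm_num)
          (x := t / s) (by positivity))
        refine Real.rpow_le_rpow (by positivity) ?_ (by linarith)
        rw [← mul_div_assoc]
        gcongr
      calc _ ≤ C * (M * s) * (‖x - w‖ / s) ^ (1 + α) :=
            hC h w s hs hwi hws hMρ hM1 x (by rw [Metric.mem_ball, dist_eq_norm]; linarith) hxi
        _ ≤ C * (M * s) * (4 ^ 2 * (t / s) ^ (1 + α)) := by gcongr
        _ = _ := by ring
    have hA := norm_sub_le_of_affine_approx (f := f) (b₀ := f z₁) (b₁ := f z₂) (z₀ := z₁)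
      (z₁ := z₂) (y := y) ht0
      (fun x hx => hε z₁ x hz₁i hz₁s (hpt x hx).1 (hpt x hx).2.1)
      (fun x hx => hε z₂ x hz₂i hz₂s (hpt x hx).1 (hpt x hx).2.2)
    calc _ ≤ 2 * (16 * C * (M * s) * (t / s) ^ (1 + α) +
          16 * C * (M * s) * (t / s) ^ (1 + α)) / t := hA
      _ = 64 * C * (M * (t / s) ^ α) := by
          rw [hsplit]
          field_simp
          ring
      _ ≤ (64 * C + 128) * (M * (t / s) ^ α) := by
          gcongr
          linarith
      _ = _ := by ring
  · have hmem : ∀ z : ℂ, 0 ≤ z.im → ‖z‖ + s ≤ 1 → z ∈ halfDisk := fun z hzi hzs =>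
      ⟨by linarith, hzi⟩
    have h1 : 1 ≤ 64 * (t / s) ^ α := by
      have h64 : (1 : ℝ) / 64 ≤ t / s := by
        rw [le_div_iff₀ hs]
        linarith
      have h2 : ((1 : ℝ) / 64) ^ α ≤ (t / s) ^ α := Real.rpow_le_rpow (by norm_num) h64 hα0.le
      have h3 : ((1 : ℝ) / 64) ^ (1 : ℝ) ≤ (1 / 64) ^ α :=
        Real.rpow_le_rpow_of_exponent_ge (by norm_num) (by norm_num) hα1.le
      rw [Real.rpow_one] at h3
      linarith
    calc _ ≤ M + M := (norm_sub_le _ _).trans (add_le_add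
          (h.norm_deriv_le z₁ (hmem z₁ hz₁i hz₁s)) (h.norm_deriv_le z₂ (hmem z₂ hz₂i hz₂s)))
      _ = 2 * M * 1 := by ring
      _ ≤ 2 * M * (64 * (t / s) ^ α) := by gcongr
      _ = 128 * (M * (t / s) ^ α) := by ring
      _ ≤ (64 * C + 128) * (M * (t / s) ^ α) := by
          gcongr
          linarith
      _ = _ := by ring

/-! ### Choice of scale and conclusion -/

lemma exists_norm_le_of_closedBall_subset_ball {c : ℂ} {r : ℝ} (hr : 0 < r)
    (hD : Metric.closedBall c r ⊆ Metric.ball (0 : ℂ) 1) :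
    ∃ R : ℝ, R < 1 ∧ ∀ z ∈ Metric.closedBall c r, ‖z‖ ≤ R := by
  obtain ⟨z₀, hz₀, hmax⟩ := (isCompact_closedBall c r).exists_isMaxOn
    ⟨c, Metric.mem_closedBall_self hr.le⟩ continuous_norm.continuousOn
  exact ⟨‖z₀‖, by simpa using hD hz₀, fun z hz => hmax hz⟩

theorem mainTheorem9 (n : ℕ) (α : ℝ≥0) (hα0 : 0 < α) (hα1 : α < 1)
    (c : ℂ) (r : ℝ) (hr : 0 < r) (hD : Metric.closedBall c r ⊆ Metric.ball (0 : ℂ) 1)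
    (ρ Λ : ℝ) (hρ : 0 < ρ) :
    ∃ C : ℝ≥0, ∀ (J : RSpace n → RSpace n →L[ℝ] RSpace n) (L K : Set (RSpace n)),
      IsAlmostComplexStructure J → IsMiddleSubmanifold L → IsTotallyReal J L →
      HasBoundedGeometryOn J L K ρ Λ →
      ∀ f : ℂ → RSpace n, IsPseudoHolomorphic J L f → MapsTo f halfDisk K →
        eHolderFullNorm α (smallHalfDisk c r) (halfDiskDeriv f) ≤
          C * ⨆ z ∈ halfDisk, (‖halfDiskDeriv f z‖ₑ + ‖halfDiskDeriv f z‖ₑ ^ 2) := by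
  have hα0' : 0 < (α : ℝ) := hα0
  have hα1' : (α : ℝ) < 1 := hα1
  obtain ⟨R, hR1, hR⟩ := exists_norm_le_of_closedBall_subset_ball hr hD
  -- `Λ` is an arbitrary real number, so it is first enlarged to at least `1`.
  obtain ⟨C, hC0, hC⟩ := exists_holder_bound hα0' hα1' (le_max_right Λ 1)
  set δ : ℝ := min (min ρ 1) (1 - R) with hδ
  have hδ0 : 0 < δ := lt_min (lt_min hρ one_pos) (by linarith)
  have hδρ : δ ≤ ρ := (min_le_left _ _).trans (min_le_left _ _)
  have hδ1 : δ ≤ 1 := (min_le_left _ _).trans (min_le_right _ _)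
  have hδR : δ ≤ 1 - R := min_le_right _ _
  set C' : ℝ≥0 := ⟨C / δ, by positivity⟩ with hC'
  refine ⟨1 + C', fun J L K hJ _ _ hgeo f hf hfK => ?_⟩
  set S : ℝ≥0∞ := ⨆ z ∈ halfDisk, (‖halfDiskDeriv f z‖ₑ + ‖halfDiskDeriv f z‖ₑ ^ 2) with hS
  rcases eq_or_ne S ⊤ with hStop | hStop
  · rw [hStop, ENNReal.mul_top (by simp)]
    exact le_top
  have hle : ∀ z ∈ halfDisk, ‖halfDiskDeriv f z‖ₑ + ‖halfDiskDeriv f z‖ₑ ^ 2 ≤ S :=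
    fun z hz => le_iSup₂ (f := fun z (_ : z ∈ halfDisk) =>
      ‖halfDiskDeriv f z‖ₑ + ‖halfDiskDeriv f z‖ₑ ^ 2) z hz
  set N : ℝ≥0 := S.toNNReal with hN
  have hNS : (N : ℝ≥0∞) = S := ENNReal.coe_toNNReal hStop
  have hleN : ∀ z ∈ halfDisk, ‖halfDiskDeriv f z‖ + ‖halfDiskDeriv f z‖ ^ 2 ≤ N := by
    intro z hz
    have h1 := hle z hz
    rw [← hNS, enorm_eq_nnnorm] at h1
    have h2 : ‖halfDiskDeriv f z‖₊ + ‖halfDiskDeriv f z‖₊ ^ 2 ≤ N := by exact_mod_cast h1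
    exact_mod_cast h2
  -- the solution of `M + M ^ 2 = N`
  obtain ⟨M, hM0, hMN⟩ : ∃ M : ℝ, 0 ≤ M ∧ M * (1 + M) = N := by
    have hsq := Real.sq_sqrt (show (0 : ℝ) ≤ 1 + 4 * N by positivity)
    refine ⟨(Real.sqrt (1 + 4 * N) - 1) / 2, ?_, by nlinarith⟩
    have : 1 ≤ Real.sqrt (1 + 4 * N) := Real.one_le_sqrt.2 (by
      have : (0 : ℝ) ≤ N := N.2
      linarith)
    linarith
  have hbd : IsBoundedHalfDisk J L K ρ (max Λ 1) M f :=
    { almostComplex := hJ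
      one_le := le_max_right _ _
      radius_pos := hρ
      geometry := hgeo.mono (le_max_left _ _)
      holomorphic := hf
      mapsTo := hfK
      -- Strict monotonicity of `x + x²` for `x ≥ 0` turns the bound by `N` into a bound of the norm
      -- by `M`.
      norm_deriv_le := fun z hz => by
        by_contra hlt
        push Not at hlt
        have := hleN z hz
        nlinarith }
  -- The largest convenient scale for which `Ms < δ` and the disks about points of the small half
  -- disk stay in the unit disk.
  set s : ℝ := δ / (1 + M) with hs
  have hs0 : 0 < s := by positivity
  have hMs : M * s < δ := by
    rw [hs, mul_div_assoc', div_lt_iff₀ (by positivity)]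
    nlinarith
  have hsR : s ≤ 1 - R := by
    refine le_trans ?_ hδR
    exact div_le_self hδ0.le (by linarith)
  have hsub : ∀ z ∈ smallHalfDisk c r, 0 ≤ z.im ∧ ‖z‖ + s ≤ 1 := fun z hz => by
    have := hR z hz.1
    exact ⟨hz.2, by linarith⟩
  have hholder : HolderWith (C' * N) α ((smallHalfDisk c r).domRestrict (halfDiskDeriv f)) := by
    rintro ⟨z₁, hz₁⟩ ⟨z₂, hz₂⟩
    have h1 := hC hbd z₁ z₂ s hs0 (hsub z₁ hz₁).1 (hsub z₂ hz₂).1 (hsub z₁ hz₁).2 (hsub z₂ hz₂).2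
      (hMs.trans_le hδρ) (hMs.le.trans hδ1)
    -- The base is at least `1` because `δ ≤ 1`, so the exponent can be raised from `α` to `1`; then
    -- `M(1 + M)/δ = N/δ`.
    have h2 : ((1 + M) / δ) ^ (α : ℝ) ≤ (1 + M) / δ := by
      have h3 : 1 ≤ (1 + M) / δ := by
        rw [le_div_iff₀ hδ0]
        linarith
      exact (Real.rpow_le_rpow_of_exponent_le h3 hα1'.le).trans_eq (Real.rpow_one _)
    have h4 : ‖halfDiskDeriv f z₁ - halfDiskDeriv f z₂‖ ≤
        C / δ * N * ‖z₁ - z₂‖ ^ (α : ℝ) := by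
      refine h1.trans ?_
      have h5 : ‖z₁ - z₂‖ / s = (1 + M) / δ * ‖z₁ - z₂‖ := by
        rw [hs]
        field_simp
      rw [h5, Real.mul_rpow (by positivity) (by positivity), ← hMN]
      calc C * M * (((1 + M) / δ) ^ (α : ℝ) * ‖z₁ - z₂‖ ^ (α : ℝ))
          ≤ C * M * ((1 + M) / δ * ‖z₁ - z₂‖ ^ (α : ℝ)) := by gcongr
        _ = _ := by ring
    have h6 : ‖halfDiskDeriv f z₁ - halfDiskDeriv f z₂‖₊ ≤
        C' * N * ‖z₁ - z₂‖₊ ^ (α : ℝ) := by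
      rw [← NNReal.coe_le_coe]
      push_cast
      exact h4
    simp only [Set.domRestrict_apply]
    rw [edist_eq_enorm_sub, Subtype.edist_mk_mk, edist_eq_enorm_sub, enorm_eq_nnnorm,
      enorm_eq_nnnorm, ← ENNReal.coe_rpow_of_nonneg ‖z₁ - z₂‖₊ (NNReal.coe_nonneg α)]
    exact_mod_cast h6
  rw [eHolderFullNorm, ENNReal.coe_add, add_mul]
  refine add_le_add ?_ ?_
  · rw [ENNReal.coe_one, one_mul]
    refine iSup₂_le fun z hz => ?_
    have hzs := hsub z hz
    exact le_self_add.trans (hle z ⟨by linarith, hzs.1⟩)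
  · refine hholder.eHolderNorm_le.trans (le_of_eq ?_)
    rw [← hNS, ENNReal.coe_mul]
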